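/- **Theorem.** There is a universal constant $C>0$ such that the following holds. Let $d,m,T$ be non-negative integers and let $\mathcal A\subseteq\{a\in\{0,1\}^d:\|a\|_1=m\}$ be a nonempty set of combinatorial actions. Let $\ell=(\ell_1,\dots,\ell_T)$ be a random sequence of loss vectors, almost surely in $[0,1]^d$, with arbitrary joint law (the prior; no independence across rounds or coordinates is assumed). Let $L^*=\min_{a\in\mathcal A}\sum_{t=1}^T\langle \ell_t,a\rangle$, and let $a^*\in\mathcal A$ be a minimizer, chosen as a measurable function of $\ell$ with ties broken arbitrarily. In Thompson Sampling with semi-bandit feedback, for each round $t=1,\dots,T$ the player draws $a_t$, using fresh randomness, from the posterior distribution of $a^*$ given $(a_1,\ell_1\odot a_1),\dots,(a_{t-1},\ell_{t-1}\odot a_{t-1})$; that is, almost surely, for every $a\in\mathcal A$, $$\mathbb P\big(a_t=a\mid \ell_1,\dots,\ell_T,a_1,\dots,a_{t-1}\big)=\mathbb P\big(a^*=a\mid a_1,\ell_1\odot a_1,\dots,a_{t-1},\ell_{t-1}\odot a_{t-1}\big).$$ Let $R_T=\sum_{t=1}^T\langle\ell_t,a_t\rangle-L^*$. If $\underline L^*\ge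 2$ is a real number with $L^*\le\underline L^*$ almost surely, then $$\mathbb E[R_T]\le C\Big((1+\log m)\sqrt{d\,\underline L^*}+m\,d^2\log^2(\underline L^*)+d\log T\Big),$$ with the convention $\log 0=0$. -/

import Mathlib

open MeasureTheory ProbabilityTheory

noncomputable section

namespace SemiBandit

/-- A loss sequence: `x t i` is the loss of arm `i` in round `t`. -/
abbrev LossSeq (d T : ℕ) : Type := Fin T → Fin d → ℝ

/-- A combinatorial action, identified with the set of arms (coordinates equal to 1) it plays. -/
abbrev Action (d : ℕ) : Type := Finset (Fin d)

/-- The total loss of the fixed action `A` over all rounds. -/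
def totalLoss {d T : ℕ} (x : LossSeq d T) (A : Action d) : ℝ :=
  ∑ t, ∑ i ∈ A, x t i

/-- The loss of the best fixed action in hindsight. -/
def bestLoss {d T : ℕ} (𝒜 : Finset (Action d)) (h𝒜 : 𝒜.Nonempty) (x : LossSeq d T) : ℝ :=
  𝒜.inf' h𝒜 (totalLoss x)

/-- A measurable rule selecting an optimal action in hindsight, with an arbitrary
deterministic way of breaking ties. -/
structure IsBestActionRule {d T : ℕ} (𝒜 : Finset (Action d))
    (best : LossSeq d T → Action d) : Prop where
  measurableSet_fiber : ∀ A, MeasurableSet {x | best x = A}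
  mem : ∀ x, best x ∈ 𝒜
  le : ∀ x, ∀ B ∈ 𝒜, totalLoss x (best x) ≤ totalLoss x B

/-- Semi-bandit feedback: the entrywise product of the loss vector with the indicator of `A`. -/
def feedback {d : ℕ} (v : Fin d → ℝ) (A : Action d) : Fin d → ℝ :=
  fun i => if i ∈ A then v i else 0

variable {Ω : Type*}

/-- The player's information at the beginning of round `t`: generated by the actions played
and the feedback received in the rounds before `t`. -/
@[reducible] def playerInfo {d T : ℕ} (loss : Ω → LossSeq d T) (play : Fin T → Ω → Action d) (t : Fin T) :
    MeasurableSpace Ω :=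
  ⨆ s : Fin T, ⨆ _ : s < t,
    MeasurableSpace.comap (play s) ⊤ ⊔
      MeasurableSpace.comap (fun ω => feedback (loss ω s) (play s ω)) inferInstance

/-- The σ-algebra generated by the whole loss sequence and the actions played before round `t`. -/
@[reducible] def fullInfo {d T : ℕ} (loss : Ω → LossSeq d T) (play : Fin T → Ω → Action d) (t : Fin T) :
    MeasurableSpace Ω :=
  MeasurableSpace.comap loss inferInstance ⊔
    ⨆ s : Fin T, ⨆ _ : s < t, MeasurableSpace.comap (play s) ⊤

/-- Thompson Sampling with semi-bandit feedback: in round `t` the action is drawn, with fresh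
randomness, from the posterior law of the optimal action given the player's information.
Conditioning the draw on the whole loss sequence and the past actions says that, apart from
the player's information, the draw depends on neither of them. This determines the
joint law of losses and actions from the law of the losses. -/
structure IsThompsonSampling {d T : ℕ} [MeasurableSpace Ω] (P : Measure Ω)
    (best : LossSeq d T → Action d) (loss : Ω → LossSeq d T)
    (play : Fin T → Ω → Action d) : Prop where
  measurableSet_fiber : ∀ t A, MeasurableSet {ω | play t ω = A}
  law : ∀ t A,
    P⟦{ω | play t ω = A} | fullInfo loss play t⟧ =ᵐ[P]
      P⟦{ω | best (loss ω) = A} | playerInfo loss play t⟧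

/-- The realized regret of the plays `a` on the loss sequence `x`. -/
def regret {d T : ℕ} (𝒜 : Finset (Action d)) (h𝒜 : 𝒜.Nonempty) (x : LossSeq d T)
    (a : Fin T → Action d) : ℝ :=
  (∑ t, ∑ i ∈ a t, x t i) - bestLoss 𝒜 h𝒜 x

end SemiBandit

end

/-! Because each draw uses fresh randomness, an arm is played, even given all losses, with its
posterior probability `p_t` of belonging to the optimal action. The expected regret is therefore the
sum over arms of E ∑ (p_t − A) l_t, where A indicates that the arm is optimal, and almost all of the
work concerns one arm (`ArmModel`).

For one arm, write A = ∑ Z_k according to the dyadic size Λ_k = L/2^k of its total loss, and let q_t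
be the posterior of Z_k. Rounds are of three kinds.

When p_t < γ, a Chernoff bound applies: jointly with optimality, the loss observed in such rounds
exceeds 2γL + log T with probability at most 1/T (`sum_integral_rare_le`).

When p_t ≥ γ, the importance-weighted loss u_t = X_t l_t / p_t estimates l_t. As long as the
accumulated estimates stay below a threshold θ_k, the regret is E u_t (q_t − q_{t+1}), since u_t is
known before round t+1. Young's inequality with potential √q splits this into a telescoping term and
a stability term of order η u_t² q_t^{3/2}. Since q_t ≤ p_t, the latter is at most of order η u_t
√q_t, and summing costs η (θ_k + γ⁻¹) E sup_t √q_t. The maximal inequality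
`exists_sqrt_posterior_le` bounds the supremum by √P(Z_k), up to a constant and a regularization ε
(`sum_integral_estimated_le`).

Once the estimates exceed θ_k, an exponential supermartingale shows that Z_k is very unlikely, and
the remaining regret is negligible (`sum_integral_exceed_le`).

With η = Λ_k^{-1/2} the main term is of order √(Λ_k P(Z_k)) per arm. Few optimal arms can have large
loss: those at scale k number at most 2^{k+1}. By Cauchy–Schwarz the sum over the d arms is of order
√(Λ_k d 2^k) = √(dL) at every scale, and O(1 + log m) scales suffice because m bounds the count at
the last one. -/

namespace SemiBandit

/-! ### Bounded measurable functions: closure properties and integrability. -/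

/-- Bounded functions that are measurable with respect to `m`. -/
structure BddMeas {Ω : Type*} (m : MeasurableSpace Ω) (f : Ω → ℝ) : Prop where
  meas : Measurable[m] f
  bdd : ∃ C, ∀ ω, |f ω| ≤ C

namespace BddMeas

variable {Ω : Type*} {m m' : MeasurableSpace Ω} {f g : Ω → ℝ}

theorem mono (hf : BddMeas m f) (h : m ≤ m') : BddMeas m' f :=
  ⟨hf.meas.mono h le_rfl, hf.bdd⟩

theorem const (c : ℝ) : BddMeas m (fun _ : Ω => c) :=
  ⟨measurable_const, |c|, fun _ => le_rfl⟩

theorem add (hf : BddMeas m f) (hg : BddMeas m g) : BddMeas m (fun ω => f ω + g ω) := by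
  obtain ⟨C, hC⟩ := hf.bdd
  obtain ⟨D, hD⟩ := hg.bdd
  exact ⟨hf.meas.add hg.meas, C + D, fun ω =>
    (abs_add_le _ _).trans (add_le_add (hC ω) (hD ω))⟩

theorem mul (hf : BddMeas m f) (hg : BddMeas m g) : BddMeas m (fun ω => f ω * g ω) := by
  obtain ⟨C, hC⟩ := hf.bdd
  obtain ⟨D, hD⟩ := hg.bdd
  refine ⟨hf.meas.mul hg.meas, C * D, fun ω => ?_⟩
  rw [abs_mul]
  exact mul_le_mul (hC ω) (hD ω) (abs_nonneg _) ((abs_nonneg _).trans (hC ω))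

theorem const_mul (c : ℝ) (hf : BddMeas m f) : BddMeas m (fun ω => c * f ω) :=
  (const c).mul hf

theorem sub (hf : BddMeas m f) (hg : BddMeas m g) : BddMeas m (fun ω => f ω - g ω) := by
  have := hf.add (hg.const_mul (-1))
  simpa [sub_eq_add_neg] using this

theorem sum {ι : Type*} (s : Finset ι) {f : ι → Ω → ℝ} (hf : ∀ i ∈ s, BddMeas m (f i)) :
    BddMeas m (fun ω => ∑ i ∈ s, f i ω) := by
  classical
  induction s using Finset.induction_on with
  | empty => simpa using const (m := m) (0 : ℝ)
  | insert a s ha ih =>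
    simp only [Finset.sum_insert ha]
    exact (hf a (by simp)).add (ih fun i hi => hf i (by simp [hi]))

theorem ite {p : Ω → Prop} [DecidablePred p] (hp : MeasurableSet[m] {ω | p ω})
    (hf : BddMeas m f) (hg : BddMeas m g) : BddMeas m (fun ω => if p ω then f ω else g ω) := by
  obtain ⟨C, hC⟩ := hf.bdd
  obtain ⟨D, hD⟩ := hg.bdd
  refine ⟨Measurable.ite hp hf.meas hg.meas, max C D, fun ω => ?_⟩
  split_ifs
  · exact (hC ω).trans (le_max_left _ _)
  · exact (hD ω).trans (le_max_right _ _)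

theorem max (hf : BddMeas m f) (hg : BddMeas m g) : BddMeas m (fun ω => f ω ⊔ g ω) := by
  obtain ⟨C, hC⟩ := hf.bdd
  obtain ⟨D, hD⟩ := hg.bdd
  exact ⟨hf.meas.max hg.meas, C ⊔ D, fun ω =>
    abs_max_le_max_abs_abs.trans (max_le_max (hC ω) (hD ω))⟩

theorem exp (hf : BddMeas m f) : BddMeas m (fun ω => Real.exp (f ω)) := by
  obtain ⟨C, hC⟩ := hf.bdd
  refine ⟨Real.measurable_exp.comp hf.meas, Real.exp C, fun ω => ?_⟩
  rw [abs_of_pos (Real.exp_pos _)]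
  exact Real.exp_le_exp.2 ((le_abs_self _).trans (hC ω))

theorem sqrt (hf : BddMeas m f) : BddMeas m (fun ω => √(f ω)) := by
  obtain ⟨C, hC⟩ := hf.bdd
  refine ⟨hf.meas.sqrt, √C, fun ω => ?_⟩
  rw [abs_of_nonneg (Real.sqrt_nonneg _)]
  exact Real.sqrt_le_sqrt ((le_abs_self _).trans (hC ω))

theorem inv {c : ℝ} (hc : 0 < c) (hf : BddMeas m f) (h : ∀ ω, c ≤ f ω) :
    BddMeas m (fun ω => (f ω)⁻¹) := by
  refine ⟨hf.meas.inv, c⁻¹, fun ω => ?_⟩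
  rw [abs_of_pos (inv_pos.2 (hc.trans_le (h ω)))]
  exact inv_anti₀ hc (h ω)

theorem of_mem_Icc (hf : Measurable[m] f) {a b : ℝ} (h : ∀ ω, f ω ∈ Set.Icc a b) :
    BddMeas m f :=
  ⟨hf, |a| ⊔ |b|, fun ω => abs_le_max_abs_abs (h ω).1 (h ω).2⟩

theorem integrable {mΩ : MeasurableSpace Ω} {P : Measure Ω} [IsFiniteMeasure P]
    (hf : BddMeas m f) (hm : m ≤ mΩ) : Integrable f P := by
  obtain ⟨C, hC⟩ := hf.bdd
  exact Integrable.of_bound (hf.meas.mono hm le_rfl).aestronglyMeasurable C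
    (Filter.Eventually.of_forall hC)

end BddMeas

/-! ### Posteriors and a maximal inequality for their square roots. -/

variable {Ω : Type*} {m mΩ : MeasurableSpace Ω}

/-- The conditional expectation of a `[0,1]`-valued variable, in a version with values
in `[0,1]`. -/
noncomputable def posterior (P : Measure Ω) (m : MeasurableSpace Ω) (Z : Ω → ℝ) : Ω → ℝ :=
  fun ω => max 0 (min 1 ((P[Z|m]) ω))

section posterior

variable {P : Measure Ω} {Z Z' : Ω → ℝ}

theorem posterior_mem (ω : Ω) : posterior P m Z ω ∈ Set.Icc (0 : ℝ) 1 :=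
  ⟨le_max_left _ _, max_le zero_le_one (min_le_left _ _)⟩

theorem bddMeas_posterior : BddMeas m (posterior P m Z) :=
  .of_mem_Icc ((measurable_const (a := (0 : ℝ))).max ((measurable_const (a := (1 : ℝ))).min
    (stronglyMeasurable_condExp (m := m)).measurable)) posterior_mem

variable [IsProbabilityMeasure P]

/-- The conditional expectation lies in [0,1] almost surely, so clipping alters it only on a null
set. What clipping buys is bounds valid at every point. -/
theorem posterior_ae_eq (hm : m ≤ mΩ) (hZ : Measurable Z)
    (h01 : ∀ ω, Z ω ∈ Set.Icc (0 : ℝ) 1) : posterior P m Z =ᵐ[P] P[Z|m] := by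
  have hi : Integrable Z P := (BddMeas.of_mem_Icc hZ h01).integrable le_rfl
  have h0 : 0 ≤ᵐ[P] P[Z|m] := condExp_nonneg (Filter.Eventually.of_forall fun ω => (h01 ω).1)
  have h1 : P[Z|m] ≤ᵐ[P] P[fun _ => (1 : ℝ)|m] :=
    condExp_mono hi (integrable_const _) (Filter.Eventually.of_forall fun ω => (h01 ω).2)
  rw [condExp_const hm] at h1
  filter_upwards [h0, h1] with ω h0 h1
  simp only [posterior]
  exact (congrArg _ (min_eq_right h1)).trans (max_eq_right h0)

theorem integral_posterior_mul (hm : m ≤ mΩ) (hZ : Measurable Z)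
    (h01 : ∀ ω, Z ω ∈ Set.Icc (0 : ℝ) 1) {f : Ω → ℝ} (hf : BddMeas m f) :
    ∫ ω, posterior P m Z ω * f ω ∂P = ∫ ω, Z ω * f ω ∂P := by
  have hZb : BddMeas mΩ Z := .of_mem_Icc hZ h01
  have h : P[fun ω => Z ω * f ω|m] =ᵐ[P] fun ω => (P[Z|m]) ω * f ω :=
    condExp_mul_of_stronglyMeasurable_right hf.meas.stronglyMeasurable
      ((hZb.mul (hf.mono hm)).integrable le_rfl) (hZb.integrable le_rfl)
  rw [← integral_condExp (f := fun ω => Z ω * f ω) hm, integral_congr_ae h]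
  apply integral_congr_ae
  filter_upwards [posterior_ae_eq (P := P) hm hZ h01] with ω hω
  rw [hω]

theorem integral_posterior (hm : m ≤ mΩ) (hZ : Measurable Z)
    (h01 : ∀ ω, Z ω ∈ Set.Icc (0 : ℝ) 1) :
    ∫ ω, posterior P m Z ω ∂P = ∫ ω, Z ω ∂P := by
  simpa using integral_posterior_mul (P := P) hm hZ h01 (BddMeas.const 1)

theorem posterior_mono (hZ : Measurable Z) (hZ' : Measurable Z')
    (h01 : ∀ ω, Z ω ∈ Set.Icc (0 : ℝ) 1) (h01' : ∀ ω, Z' ω ∈ Set.Icc (0 : ℝ) 1)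
    (h : ∀ ω, Z ω ≤ Z' ω) : ∀ᵐ ω ∂P, posterior P m Z ω ≤ posterior P m Z' ω := by
  have h1 : P[Z|m] ≤ᵐ[P] P[Z'|m] :=
    condExp_mono ((BddMeas.of_mem_Icc hZ h01).integrable le_rfl)
      ((BddMeas.of_mem_Icc hZ' h01').integrable le_rfl) (Filter.Eventually.of_forall h)
  filter_upwards [h1] with ω hω
  exact max_le_max le_rfl (min_le_min le_rfl hω)

/-- Multiplying by an indicator that is already known pulls out of the posterior. -/
theorem posterior_mul_le (hm : m ≤ mΩ) (hZ : Measurable Z) (hZ' : Measurable Z')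
    (h01 : ∀ ω, Z ω ∈ Set.Icc (0 : ℝ) 1) (h01' : ∀ ω, Z' ω ∈ Set.Icc (0 : ℝ) 1)
    {f : Ω → ℝ} (hf : BddMeas m f) (h : ∀ ω, Z ω * f ω ≤ Z' ω) :
    ∀ᵐ ω ∂P, posterior P m Z ω * f ω ≤ posterior P m Z' ω := by
  have hZb : BddMeas mΩ Z := .of_mem_Icc hZ h01
  have h1 : P[fun ω => Z ω * f ω|m] =ᵐ[P] fun ω => (P[Z|m]) ω * f ω :=
    condExp_mul_of_stronglyMeasurable_right hf.meas.stronglyMeasurable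
      ((hZb.mul (hf.mono hm)).integrable le_rfl) (hZb.integrable le_rfl)
  have h2 : P[fun ω => Z ω * f ω|m] ≤ᵐ[P] P[Z'|m] :=
    condExp_mono ((hZb.mul (hf.mono hm)).integrable le_rfl)
      ((BddMeas.of_mem_Icc hZ' h01').integrable le_rfl) (Filter.Eventually.of_forall h)
  filter_upwards [h1, h2, posterior_ae_eq (P := P) hm hZ h01,
    posterior_ae_eq (P := P) hm hZ' h01'] with ω e1 e2 e3 e4
  rw [e3, e4, ← e1]
  exact e2

/-- Jensen's inequality, obtained by integrating the tangent line of the concave function √ at c. -/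
theorem integral_sqrt_le {f : Ω → ℝ} (hf : BddMeas mΩ f) {c : ℝ} (hc : 0 < c)
    (h : ∀ ω, 0 ≤ f ω) (hfc : ∫ ω, f ω ∂P ≤ c) : ∫ ω, √(f ω) ∂P ≤ √c := by
  have hs : 0 < √c := Real.sqrt_pos.2 hc
  have hss : √c * √c = c := Real.mul_self_sqrt hc.le
  have key : ∀ ω, √(f ω) ≤ (2 * √c)⁻¹ * f ω + √c / 2 := fun ω => by
    have h1 := Real.mul_self_sqrt (h ω)
    have h2 : (2 * √c)⁻¹ * f ω + √c / 2 - √(f ω) = (2 * √c)⁻¹ * (√(f ω) - √c) ^ 2 := by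
      field_simp
      nlinarith
    have h3 : 0 ≤ (2 * √c)⁻¹ * (√(f ω) - √c) ^ 2 := by positivity
    linarith
  calc ∫ ω, √(f ω) ∂P ≤ ∫ ω, ((2 * √c)⁻¹ * f ω + √c / 2) ∂P :=
        integral_mono (hf.sqrt.integrable le_rfl)
          (((hf.const_mul _).add (.const _)).integrable le_rfl) key
    _ = (2 * √c)⁻¹ * ∫ ω, f ω ∂P + √c / 2 := by
        rw [integral_add ((hf.const_mul _).integrable le_rfl) (integrable_const _),
          integral_const_mul]
        simp
    _ ≤ (2 * √c)⁻¹ * c + √c / 2 := by gcongr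
    _ = √c := by
        field_simp
        nlinarith

/-- A maximal inequality for the square root of a closed martingale. -/
theorem exists_sqrt_posterior_le {F : ℕ → MeasurableSpace Ω} (hF : Monotone F)
    (hFm : ∀ t, F t ≤ mΩ) (hZ : Measurable Z) (h01 : ∀ ω, Z ω ∈ Set.Icc (0 : ℝ) 1)
    {ε : ℝ} (hε : 0 < ε) (n : ℕ) :
    ∃ S : Ω → ℝ, BddMeas mΩ S ∧ (∀ ω, 0 ≤ S ω) ∧
      (∀ t ≤ n, ∀ ω, √(posterior P (F t) Z ω + ε) ≤ S ω) ∧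
      ∫ ω, S ω ∂P ≤ 2 * √(∫ ω, Z ω ∂P + ε) := by
  -- The shift by ε keeps the martingale away from 0, so that inverse square roots are bounded.
  set M : ℕ → Ω → ℝ := fun t ω => posterior P (F t) Z ω + ε with hM
  have hMb : ∀ t, BddMeas (F t) (M t) := fun t => bddMeas_posterior.add (.const _)
  have hMε : ∀ t ω, ε ≤ M t ω := fun t ω => le_add_of_nonneg_left (posterior_mem ω).1
  -- R is the running maximum of M. The process √R + M/√R is a supermartingale: while R is frozen
  -- only the martingale M moves, and at a new record AM–GM gives 2√M ≤ √R + M/√R. It starts at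
  -- 2√M₀.
  have main : ∀ n, ∃ R : Ω → ℝ, BddMeas (F n) R ∧ (∀ ω, ε ≤ R ω) ∧
      (∀ t ≤ n, ∀ ω, M t ω ≤ R ω) ∧
      ∫ ω, (√(R ω) + M n ω * (√(R ω))⁻¹) ∂P ≤ 2 * ∫ ω, √(M 0 ω) ∂P := by
    intro n
    induction n with
    | zero =>
      refine ⟨M 0, hMb 0, hMε 0, fun t ht ω => by rw [Nat.le_zero.1 ht], ?_⟩
      rw [← integral_const_mul]
      refine (integral_congr_ae (Filter.Eventually.of_forall fun ω => ?_)).le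
      have h0 : 0 < M 0 ω := hε.trans_le (hMε 0 ω)
      have h1 := Real.mul_self_sqrt h0.le
      have h2 := Real.sqrt_pos.2 h0
      field_simp
      nlinarith
    | succ n ih =>
      obtain ⟨R, hRb, hRε, hRM, hR⟩ := ih
      have hs : ∀ ω, √ε ≤ √(R ω) := fun ω => Real.sqrt_le_sqrt (hRε ω)
      have hsε : 0 < √ε := Real.sqrt_pos.2 hε
      have hinv : BddMeas (F n) (fun ω => (√(R ω))⁻¹) := hRb.sqrt.inv hsε hs
      have hR'b : BddMeas (F (n + 1)) (fun ω => max (R ω) (M (n + 1) ω)) :=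
        (hRb.mono (hF n.le_succ)).max (hMb (n + 1))
      have hR'ε : ∀ ω, ε ≤ max (R ω) (M (n + 1) ω) := fun ω => (hRε ω).trans (le_max_left _ _)
      refine ⟨fun ω => max (R ω) (M (n + 1) ω), hR'b, hR'ε, fun t ht ω => ?_, ?_⟩
      · rcases Nat.le_succ_iff.1 ht with h | h
        · exact (hRM t h ω).trans (le_max_left _ _)
        · rw [h]
          exact le_max_right _ _
      have hinv' : BddMeas (F (n + 1)) (fun ω => (√(max (R ω) (M (n + 1) ω)))⁻¹) :=
        hR'b.sqrt.inv hsε fun ω => Real.sqrt_le_sqrt (hR'ε ω)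
      have e : ∀ k, n ≤ k → ∫ ω, M k ω * (√(R ω))⁻¹ ∂P
          = ∫ ω, Z ω * (√(R ω))⁻¹ ∂P + ∫ ω, ε * (√(R ω))⁻¹ ∂P := fun k hk => by
        rw [← integral_posterior_mul (hFm k) hZ h01 (hinv.mono (hF hk)), ← integral_add
          ((bddMeas_posterior.mul (hinv.mono (hF hk))).integrable (hFm k))
          ((hinv.const_mul ε).integrable (hFm n))]
        exact integral_congr_ae (Filter.Eventually.of_forall fun ω => add_mul _ _ _)
      calc _ ≤ ∫ ω, (√(R ω) + M (n + 1) ω * (√(R ω))⁻¹) ∂P := by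
            refine integral_mono ((hR'b.sqrt.add ((hMb _).mul hinv')).integrable (hFm _))
              (((hRb.sqrt.mono (hF n.le_succ)).add ((hMb _).mul
                (hinv.mono (hF n.le_succ)))).integrable (hFm _)) fun ω => ?_
            beta_reduce
            rcases le_total (M (n + 1) ω) (R ω) with h | h
            · rw [max_eq_left h]
            · rw [max_eq_right h]
              have hr : 0 < √(R ω) := hsε.trans_le (hs ω)
              have hm0 : 0 < M (n + 1) ω := hε.trans_le (hMε _ ω)
              have hm : 0 < √(M (n + 1) ω) := Real.sqrt_pos.2 hm0
              have h1 := Real.mul_self_sqrt hm0.le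
              have h2 : M (n + 1) ω * (√(M (n + 1) ω))⁻¹ = √(M (n + 1) ω) := by
                field_simp
                nlinarith
              have h3 : √(R ω) + M (n + 1) ω * (√(R ω))⁻¹ - 2 * √(M (n + 1) ω)
                  = (√(R ω))⁻¹ * (√(R ω) - √(M (n + 1) ω)) ^ 2 := by
                field_simp
                nlinarith
              have h4 : 0 ≤ (√(R ω))⁻¹ * (√(R ω) - √(M (n + 1) ω)) ^ 2 := by positivity
              linarith
        _ = ∫ ω, (√(R ω) + M n ω * (√(R ω))⁻¹) ∂P := by
            rw [integral_add (hRb.sqrt.integrable (hFm n))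
              (((hMb _).mul (hinv.mono (hF n.le_succ))).integrable (hFm _)),
              integral_add (hRb.sqrt.integrable (hFm n)) (((hMb _).mul hinv).integrable (hFm n)),
              e n le_rfl, e (n + 1) n.le_succ]
        _ ≤ _ := hR
  obtain ⟨R, hRb, hRε, hRM, hR⟩ := main n
  have hsε : 0 < √ε := Real.sqrt_pos.2 hε
  have hinv : BddMeas (F n) (fun ω => (√(R ω))⁻¹) :=
    hRb.sqrt.inv hsε fun ω => Real.sqrt_le_sqrt (hRε ω)
  refine ⟨fun ω => √(R ω), hRb.sqrt.mono (hFm n), fun ω => Real.sqrt_nonneg _,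
    fun t ht ω => Real.sqrt_le_sqrt (hRM t ht ω), ?_⟩
  calc ∫ ω, √(R ω) ∂P ≤ ∫ ω, (√(R ω) + M n ω * (√(R ω))⁻¹) ∂P :=
        integral_mono (hRb.sqrt.integrable (hFm n))
          ((hRb.sqrt.add ((hMb n).mul hinv)).integrable (hFm n)) fun ω =>
          le_add_of_nonneg_right (mul_nonneg (hε.le.trans (hMε n ω))
            (inv_nonneg.2 (Real.sqrt_nonneg _)))
    _ ≤ 2 * ∫ ω, √(M 0 ω) ∂P := hR
    _ ≤ 2 * √(∫ ω, Z ω ∂P + ε) := by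
        have h0 : 0 ≤ ∫ ω, Z ω ∂P := integral_nonneg fun ω => (h01 ω).1
        gcongr
        refine integral_sqrt_le ((hMb 0).mono (hFm 0)) (by positivity)
          (fun ω => hε.le.trans (hMε 0 ω)) ?_
        rw [hM, integral_add (bddMeas_posterior.integrable (hFm 0)) (integrable_const _),
          integral_posterior (hFm 0) hZ h01]
        simp

end posterior

/-! ### One arm: concentration, rare rounds and exceeded thresholds. -/

/-- The part of a sum of nonnegative terms that is collected before the partial sums exceed a
level exceeds that level by at most one term. -/
theorem sum_capped_le (a : ℕ → ℝ) {θ b : ℝ} (hθ : 0 ≤ θ) (n : ℕ)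
    (ha : ∀ t < n, 0 ≤ a t ∧ a t ≤ b) (hb : 0 ≤ b) :
    ∑ t ∈ Finset.range n, (if ∑ s ∈ Finset.range t, a s ≤ θ then a t else 0) ≤ θ + b := by
  -- The second conjunct drives the induction: if the test passes at n, the capped sum so far is at
  -- most the full sum, hence at most θ, and one term adds at most b.
  have : ∑ t ∈ Finset.range n, (if ∑ s ∈ Finset.range t, a s ≤ θ then a t else 0) ≤ θ + b ∧
      ∑ t ∈ Finset.range n, (if ∑ s ∈ Finset.range t, a s ≤ θ then a t else 0)
        ≤ ∑ t ∈ Finset.range n, a t := by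
    induction n with
    | zero => simp; positivity
    | succ n ih =>
      obtain ⟨h1, h2⟩ := ih fun t ht => ha t (by omega)
      have h3 := ha n (by omega)
      rw [Finset.sum_range_succ, Finset.sum_range_succ]
      split_ifs <;> constructor <;> linarith
  exact this.1

/-- A single arm of a semi-bandit over `T` rounds: `F t` is the information of the player before
round `t`, `G t` contains in addition all losses, `X t` indicates that the arm is played in
round `t`, `l t` is its loss and `A` indicates that the arm belongs to the optimal action.
Conditionally on `G t` the arm is played with its posterior probability of being optimal. -/
structure ArmModel {Ω : Type*} {mΩ : MeasurableSpace Ω} (P : Measure Ω) (T : ℕ)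
    (F G : ℕ → MeasurableSpace Ω) (X l : ℕ → Ω → ℝ) (A : Ω → ℝ) : Prop where
  F_mono : Monotone F
  F_le_G : ∀ t, F t ≤ G t
  G_le : ∀ t, G t ≤ mΩ
  X_eq : ∀ t ω, X t ω = 0 ∨ X t ω = 1
  l_mem : ∀ t ω, l t ω ∈ Set.Icc (0 : ℝ) 1
  A_mem : ∀ ω, A ω ∈ Set.Icc (0 : ℝ) 1
  measurable_X : ∀ t, Measurable[mΩ] (X t)
  measurable_Xl : ∀ t, Measurable[F (t + 1)] (fun ω => X t ω * l t ω)
  measurable_l : ∀ s t, Measurable[G t] (l s)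
  measurable_A : Measurable[mΩ] A
  condExp_X : ∀ t < T, P[X t|G t] =ᵐ[P] P[A|F t]

namespace ArmModel

variable {Ω : Type*} {mΩ : MeasurableSpace Ω} {P : Measure Ω} {T : ℕ}
  {F G : ℕ → MeasurableSpace Ω} {X l : ℕ → Ω → ℝ} {A : Ω → ℝ}

theorem F_le (h : ArmModel P T F G X l A) (t : ℕ) : F t ≤ mΩ := (h.F_le_G t).trans (h.G_le t)

theorem bddMeas_l (h : ArmModel P T F G X l A) (s t : ℕ) : BddMeas (G t) (l s) :=
  .of_mem_Icc (h.measurable_l s t) (h.l_mem s)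

theorem X_mem (h : ArmModel P T F G X l A) (t : ℕ) (ω : Ω) : X t ω ∈ Set.Icc (0 : ℝ) 1 := by
  rcases h.X_eq t ω with e | e <;> simp [e]

theorem Xl_mem (h : ArmModel P T F G X l A) (t : ℕ) (ω : Ω) :
    X t ω * l t ω ∈ Set.Icc (0 : ℝ) 1 := by
  have := h.l_mem t ω
  rcases h.X_eq t ω with e | e <;> simp [e, this.1, this.2]

theorem bddMeas_Xl (h : ArmModel P T F G X l A) {s t : ℕ} (hst : s < t) :
    BddMeas (F t) (fun ω => X s ω * l s ω) :=
  .mono (.of_mem_Icc (h.measurable_Xl s) (h.Xl_mem s)) (h.F_mono hst)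

theorem bddMeas_X (h : ArmModel P T F G X l A) (t : ℕ) : BddMeas mΩ (X t) :=
  .of_mem_Icc (h.measurable_X t) (h.X_mem t)

/-- Weighted observed losses are known to the player. -/
theorem bddMeas_sum (h : ArmModel P T F G X l A) {w : ℕ → Ω → ℝ}
    (hw : ∀ t, BddMeas (F t) (w t)) (t : ℕ) :
    BddMeas (F t) (fun ω => ∑ s ∈ Finset.range t, w s ω * (X s ω * l s ω)) :=
  .sum _ fun s hs => ((hw s).mono (h.F_mono (Finset.mem_range.1 hs).le)).mul
    (h.bddMeas_Xl (Finset.mem_range.1 hs))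

variable [IsProbabilityMeasure P]

/-- Fresh randomness: given all losses and the past, the arm is played with its posterior
probability. -/
theorem integral_X_mul (h : ArmModel P T F G X l A) {t : ℕ} (ht : t < T) {f : Ω → ℝ}
    (hf : BddMeas (G t) f) :
    ∫ ω, X t ω * f ω ∂P = ∫ ω, posterior P (F t) A ω * f ω ∂P := by
  have e : P[fun ω => X t ω * f ω|G t] =ᵐ[P] fun ω => (P[X t|G t]) ω * f ω :=
    condExp_mul_of_stronglyMeasurable_right hf.meas.stronglyMeasurable
      (((h.bddMeas_X t).mul (hf.mono (h.G_le t))).integrable le_rfl)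
      ((h.bddMeas_X t).integrable le_rfl)
  rw [← integral_condExp (f := fun ω => X t ω * f ω) (h.G_le t), integral_congr_ae e]
  apply integral_congr_ae
  filter_upwards [h.condExp_X t ht,
    posterior_ae_eq (P := P) (h.F_le t) h.measurable_A h.A_mem] with ω h1 h2
  rw [h1, h2]

/-- An exponential supermartingale controlling the weighted observed losses. -/
theorem integral_exp_le (h : ArmModel P T F G X l A) {w : ℕ → Ω → ℝ}
    (hw : ∀ t, BddMeas (F t) (w t)) {c : ℝ} (hc : 0 ≤ c) (hw0 : ∀ t ω, 0 ≤ w t ω)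
    (hw1 : ∀ t ω, c * w t ω ≤ 1) {n : ℕ} (hn : n ≤ T) :
    ∫ ω, Real.exp (c * ∑ s ∈ Finset.range n, w s ω * (X s ω * l s ω)
      - 2 * c * ∑ s ∈ Finset.range n, posterior P (F s) A ω * w s ω * l s ω) ∂P ≤ 1 := by
  induction n with
  | zero => simp
  | succ n ih =>
    refine le_trans ?_ (ih (by omega))
    have hwG : ∀ t, BddMeas (G t) (w t) := fun t => (hw t).mono (h.F_le_G t)
    have hpG : ∀ s ≤ n, BddMeas (G n) (posterior P (F s) A) := fun s hs =>
      bddMeas_posterior.mono ((h.F_mono hs).trans (h.F_le_G n))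
    set E : Ω → ℝ := fun ω => Real.exp (c * ∑ s ∈ Finset.range n, w s ω * (X s ω * l s ω)
      - 2 * c * ∑ s ∈ Finset.range n, posterior P (F s) A ω * w s ω * l s ω) with hE
    have hEb : BddMeas (G n) E :=
      ((((h.bddMeas_sum hw n).mono (h.F_le_G n)).const_mul c).sub
        (.const_mul (2 * c) (.sum _ fun s hs => (((hpG s (Finset.mem_range.1 hs).le).mul
          ((hw s).mono ((h.F_mono (Finset.mem_range.1 hs).le).trans (h.F_le_G n)))).mul
            (h.bddMeas_l s n))))).exp
    set a : Ω → ℝ := fun ω => c * (w n ω * l n ω) with ha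
    have hab : BddMeas (G n) a := ((hwG n).mul (h.bddMeas_l n n)).const_mul c
    have ha0 : ∀ ω, 0 ≤ a ω := fun ω =>
      mul_nonneg hc (mul_nonneg (hw0 n ω) (h.l_mem n ω).1)
    have ha1 : ∀ ω, a ω ≤ 1 := fun ω => by
      have h1 := mul_le_mul (hw1 n ω) (h.l_mem n ω).2 (h.l_mem n ω).1 zero_le_one
      simp only [ha]
      linarith
    set g : Ω → ℝ := fun ω => E ω * Real.exp (-2 * (posterior P (F n) A ω * a ω)) with hg
    have hgb : BddMeas (G n) g := hEb.mul (((hpG n le_rfl).mul hab).const_mul (-2)).exp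
    have hfb : BddMeas (G n) (fun ω => g ω * (Real.exp (a ω) - 1)) :=
      hgb.mul (hab.exp.sub (.const 1))
    -- As X is 0 or 1, exp(aX) = 1 + X (exp a − 1) is affine in X, so `integral_X_mul` can replace X
    -- by the posterior.
    calc _ = ∫ ω, (g ω + X n ω * (g ω * (Real.exp (a ω) - 1))) ∂P := by
          refine integral_congr_ae (Filter.Eventually.of_forall fun ω => ?_)
          simp only [Finset.sum_range_succ, hg, hE, ha]
          rcases h.X_eq n ω with e | e
          · rw [e, ← Real.exp_add]
            simp only [zero_mul, mul_zero, add_zero]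
            congr 1
            ring
          · rw [e]
            simp only [one_mul]
            rw [show ∀ x y : ℝ, x + x * (y - 1) = x * y from fun x y => by ring, ← Real.exp_add,
              ← Real.exp_add]
            congr 1
            ring
      _ = ∫ ω, (g ω + posterior P (F n) A ω * (g ω * (Real.exp (a ω) - 1))) ∂P := by
          rw [integral_add (hgb.integrable (h.G_le n))
            (((h.bddMeas_X n).mul (hfb.mono (h.G_le n))).integrable le_rfl),
            h.integral_X_mul (by omega) hfb, integral_add (hgb.integrable (h.G_le n))
            (((hpG n le_rfl).mul hfb).integrable (h.G_le n))]
      _ ≤ ∫ ω, E ω ∂P := by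
          refine integral_mono ((hgb.add ((hpG n le_rfl).mul hfb)).integrable (h.G_le n))
            (hEb.integrable (h.G_le n)) fun ω => ?_
          have hp := posterior_mem (P := P) (m := F n) (Z := A) ω
          -- Valid for 0 ≤ a ≤ 1, which is why c w ≤ 1 is required; this is the source of the factor
          -- 2 in the compensator.
          have h1 : Real.exp (a ω) - 1 ≤ 2 * a ω := by
            have := Real.abs_exp_sub_one_le (x := a ω) (by rw [abs_of_nonneg (ha0 ω)]; exact ha1 ω)
            rw [abs_of_nonneg (ha0 ω)] at this
            exact (le_abs_self _).trans this
          have h2 : 1 + posterior P (F n) A ω * (Real.exp (a ω) - 1)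
              ≤ Real.exp (2 * (posterior P (F n) A ω * a ω)) := by
            have := Real.add_one_le_exp (2 * (posterior P (F n) A ω * a ω))
            have := mul_le_mul_of_nonneg_left h1 hp.1
            linarith
          have hE0 : 0 ≤ E ω := (Real.exp_pos _).le
          have hg0 : 0 ≤ g ω := mul_nonneg hE0 (Real.exp_pos _).le
          calc g ω + posterior P (F n) A ω * (g ω * (Real.exp (a ω) - 1))
              = g ω * (1 + posterior P (F n) A ω * (Real.exp (a ω) - 1)) := by ring
            _ ≤ g ω * Real.exp (2 * (posterior P (F n) A ω * a ω)) :=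
                mul_le_mul_of_nonneg_left h2 hg0
            _ = E ω := by
                rw [hg]
                beta_reduce
                rw [mul_assoc, ← Real.exp_add]
                simp

/-- If the weighted losses of an arm in `Z` are small, then large weighted observed losses are
unlikely. -/
theorem integral_mul_exceed_le (h : ArmModel P T F G X l A) {w : ℕ → Ω → ℝ}
    (hw : ∀ t, BddMeas (F t) (w t)) {c : ℝ} (hc : 0 ≤ c) (hw0 : ∀ t ω, 0 ≤ w t ω)
    (hw1 : ∀ t ω, c * w t ω ≤ 1) {n : ℕ} (hn : n ≤ T) {Z : Ω → ℝ} (hZ : Measurable Z)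
    (hZ01 : ∀ ω, Z ω ∈ Set.Icc (0 : ℝ) 1) {V : ℝ}
    (hV : ∀ ω, Z ω ≠ 0 → ∑ s ∈ Finset.range n, posterior P (F s) A ω * w s ω * l s ω ≤ V)
    (θ : ℝ) :
    ∫ ω, Z ω * (if θ < ∑ s ∈ Finset.range n, w s ω * (X s ω * l s ω) then 1 else 0) ∂P
      ≤ Real.exp (2 * c * V - c * θ) := by
  set E : Ω → ℝ := fun ω => Real.exp (c * ∑ s ∈ Finset.range n, w s ω * (X s ω * l s ω)
      - 2 * c * ∑ s ∈ Finset.range n, posterior P (F s) A ω * w s ω * l s ω) with hE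
  have hEb : BddMeas mΩ E :=
    ((((h.bddMeas_sum hw n).mono (h.F_le n)).const_mul c).sub
      (.const_mul (2 * c) (.sum _ fun s _ => (((bddMeas_posterior.mono (h.F_le s)).mul
        ((hw s).mono (h.F_le s))).mul ((h.bddMeas_l s 0).mono (h.G_le 0)))))).exp
  have hWb := (h.bddMeas_sum hw n).mono (h.F_le n)
  calc _ ≤ ∫ ω, Real.exp (2 * c * V - c * θ) * E ω ∂P := by
        refine integral_mono (((BddMeas.of_mem_Icc hZ hZ01).mul
          (.ite (measurableSet_lt measurable_const hWb.meas) (.const 1)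
            (.const 0))).integrable le_rfl) ((hEb.const_mul _).integrable le_rfl) fun ω => ?_
        by_cases hz : Z ω = 0
        · simp only [hz, zero_mul]
          exact mul_nonneg (Real.exp_pos _).le (Real.exp_pos _).le
        have h1 := hV ω hz
        beta_reduce
        split_ifs with h2
        · rw [mul_one, hE]
          beta_reduce
          rw [← Real.exp_add]
          refine (hZ01 ω).2.trans (Real.one_le_exp ?_)
          have h3 := mul_le_mul_of_nonneg_left h1 hc
          have h4 := mul_le_mul_of_nonneg_left h2.le hc
          linarith
        · rw [mul_zero]
          exact mul_nonneg (Real.exp_pos _).le (Real.exp_pos _).le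
    _ = Real.exp (2 * c * V - c * θ) * ∫ ω, E ω ∂P := integral_const_mul _ _
    _ ≤ Real.exp (2 * c * V - c * θ) * 1 :=
        mul_le_mul_of_nonneg_left (h.integral_exp_le hw hc hw0 hw1 hn) (Real.exp_pos _).le
    _ = _ := mul_one _

/-- The loss suffered in rounds in which the arm is played with small probability. -/
theorem sum_integral_rare_le (h : ArmModel P T F G X l A) {γ L : ℝ} (hγ : 0 ≤ γ) (hL0 : 0 ≤ L)
    (hL : ∀ ω, A ω ≠ 0 → ∑ t ∈ Finset.range T, l t ω ≤ L) :
    ∑ t ∈ Finset.range T, ∫ ω, posterior P (F t) A ω *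
      ((if posterior P (F t) A ω < γ then 1 else 0) * l t ω) ∂P ≤ 2 * γ * L + Real.log T + 2 := by
  set w : ℕ → Ω → ℝ := fun t ω => if posterior P (F t) A ω < γ then 1 else 0 with hw_def
  have hw : ∀ t, BddMeas (F t) (w t) := fun t =>
    .ite (measurableSet_lt bddMeas_posterior.meas measurable_const) (.const 1) (.const 0)
  have hw01 : ∀ t ω, w t ω ∈ Set.Icc (0 : ℝ) 1 := fun t ω => by
    simp only [hw_def]
    split_ifs <;> simp
  set W : ℕ → Ω → ℝ := fun t ω => ∑ s ∈ Finset.range t, w s ω * (X s ω * l s ω) with hW_def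
  have hW : ∀ t, BddMeas (F t) (W t) := h.bddMeas_sum hw
  -- The first summand absorbs the compensator, at most 2γL when the arm is optimal; the log T makes
  -- the failure probability 1/T in each round, hence a total cost of 1.
  set θ : ℝ := 2 * γ * L + Real.log T with hθ
  have hlog : 0 ≤ Real.log T := Real.log_natCast_nonneg T
  have hθ0 : 0 ≤ θ := by positivity
  have hlowb : ∀ t, BddMeas (F t) (fun ω => if W t ω ≤ θ then w t ω else 0) := fun t =>
    .ite (measurableSet_le (hW t).meas measurable_const) (hw t) (.const 0)
  have hhighb : ∀ t, BddMeas (F t) (fun ω => if θ < W t ω then (1 : ℝ) else 0) := fun t =>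
    .ite (measurableSet_lt measurable_const (hW t).meas) (.const 1) (.const 0)
  have step : ∀ t ∈ Finset.range T, ∫ ω, posterior P (F t) A ω * (w t ω * l t ω) ∂P
      ≤ ∫ ω, (if W t ω ≤ θ then w t ω * (X t ω * l t ω) else 0) ∂P + (T : ℝ)⁻¹ := by
    intro t ht
    have ht' : t < T := Finset.mem_range.1 ht
    have hT : (0 : ℝ) < T := by exact_mod_cast (Nat.zero_le t).trans_lt ht'
    have hp : BddMeas mΩ (posterior P (F t) A) := bddMeas_posterior.mono (h.F_le t)
    have hl := (h.bddMeas_l t t).mono (h.G_le t)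
    have b1 := hp.mul (((hlowb t).mono (h.F_le t)).mul hl)
    have b2 := hp.mul ((hhighb t).mono (h.F_le t))
    -- Below the threshold the posterior is exchanged for the play X, giving observed losses that
    -- the cap controls. Above it, since the event is known to the player, the posterior is
    -- exchanged for A, where Chernoff applies.
    calc _ ≤ ∫ ω, (posterior P (F t) A ω * ((if W t ω ≤ θ then w t ω else 0) * l t ω)
          + posterior P (F t) A ω * (if θ < W t ω then (1 : ℝ) else 0)) ∂P := by
          refine integral_mono ((hp.mul (((hw t).mono (h.F_le t)).mul hl)).integrable le_rfl)
            ((b1.add b2).integrable le_rfl) fun ω => ?_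
          have h1 := posterior_mem (P := P) (m := F t) (Z := A) ω
          have h2 := h.l_mem t ω
          have h3 := hw01 t ω
          beta_reduce
          by_cases hc : W t ω ≤ θ
          · simp [hc, not_lt.2 hc]
          · simp only [hc, if_false, not_le.1 hc, if_true, zero_mul, mul_zero, zero_add, mul_one]
            exact mul_le_of_le_one_right h1.1 (mul_le_one₀ h3.2 h2.1 h2.2)
      _ = ∫ ω, X t ω * ((if W t ω ≤ θ then w t ω else 0) * l t ω) ∂P
          + ∫ ω, A ω * (if θ < W t ω then (1 : ℝ) else 0) ∂P := by
          rw [integral_add (b1.integrable le_rfl) (b2.integrable le_rfl),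
            h.integral_X_mul ht' (((hlowb t).mono (h.F_le_G t)).mul (h.bddMeas_l t t)),
            integral_posterior_mul (h.F_le t) h.measurable_A h.A_mem (hhighb t)]
      _ ≤ _ := by
          refine add_le_add (integral_congr_ae (Filter.Eventually.of_forall fun ω => ?_)).le ?_
          · split_ifs <;> ring
          · refine (h.integral_mul_exceed_le (c := 1) (V := γ * L) hw zero_le_one
              (fun t ω => (hw01 t ω).1) (fun t ω => by simpa using (hw01 t ω).2) ht'.le
              h.measurable_A h.A_mem (fun ω hω => ?_) θ).trans ?_
            · calc _ ≤ ∑ s ∈ Finset.range t, γ * l s ω := by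
                    refine Finset.sum_le_sum fun s _ =>
                      mul_le_mul_of_nonneg_right ?_ (h.l_mem s ω).1
                    simp only [hw_def]
                    split_ifs with hs
                    · simpa using hs.le
                    · simpa using hγ
                _ ≤ ∑ s ∈ Finset.range T, γ * l s ω :=
                    Finset.sum_le_sum_of_subset_of_nonneg
                      (Finset.range_subset_range.2 ht'.le)
                      fun s _ _ => mul_nonneg hγ (h.l_mem s ω).1
                _ = γ * ∑ s ∈ Finset.range T, l s ω := by rw [Finset.mul_sum]
                _ ≤ γ * L := mul_le_mul_of_nonneg_left (hL ω hω) hγ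
            · rw [hθ, show 2 * 1 * (γ * L) - 1 * (2 * γ * L + Real.log T) = -Real.log T by ring,
                Real.exp_neg, Real.exp_log hT]
  have hXb : ∀ t, BddMeas mΩ (fun ω => if W t ω ≤ θ then w t ω * (X t ω * l t ω) else 0) :=
    fun t => .ite (measurableSet_le ((hW t).mono (h.F_le t)).meas measurable_const)
      (((hw t).mono (h.F_le t)).mul ((h.bddMeas_Xl t.lt_succ_self).mono (h.F_le _))) (.const 0)
  have fin : ∑ t ∈ Finset.range T, ∫ ω, (if W t ω ≤ θ then w t ω * (X t ω * l t ω) else 0) ∂P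
      ≤ θ + 1 := by
    rw [← integral_finsetSum _ fun t _ => (hXb t).integrable le_rfl]
    calc _ ≤ ∫ _, (θ + 1) ∂P := by
          refine integral_mono ((BddMeas.sum _ fun t _ => hXb t).integrable le_rfl)
            (integrable_const _) fun ω => ?_
          refine sum_capped_le (fun t => w t ω * (X t ω * l t ω)) hθ0 T (fun t _ => ⟨?_, ?_⟩)
            zero_le_one
          · exact mul_nonneg (hw01 t ω).1 (h.Xl_mem t ω).1
          · exact mul_le_one₀ (hw01 t ω).2 (h.Xl_mem t ω).1 (h.Xl_mem t ω).2
      _ = θ + 1 := by simp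
  refine (Finset.sum_le_sum step).trans ?_
  rw [Finset.sum_add_distrib, Finset.sum_const, Finset.card_range, nsmul_eq_mul]
  have : (T : ℝ) * (T : ℝ)⁻¹ ≤ 1 := mul_inv_le_one
  linarith

/-- The loss suffered in rounds in which the arm is played with large probability although the
event `Z` has been made unlikely by the past (`B t = 1`). -/
theorem sum_integral_exceed_le (h : ArmModel P T F G X l A) {γ L δ : ℝ} (hγ : 0 < γ)
    (hL0 : 0 ≤ L) (hδ : 0 < δ) (hL : ∀ ω, A ω ≠ 0 → ∑ t ∈ Finset.range T, l t ω ≤ L)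
    {Z : Ω → ℝ} (hZ : Measurable Z) (hZ01 : ∀ ω, Z ω ∈ Set.Icc (0 : ℝ) 1)
    {v B : ℕ → Ω → ℝ} {B' : Ω → ℝ} (hv : ∀ t, BddMeas (F t) (v t))
    (hv0 : ∀ t ω, 0 ≤ v t ω) (hv1 : ∀ t ω, v t ω ≤ γ⁻¹) (hB : ∀ t, BddMeas (F t) (B t))
    (hB01 : ∀ t ω, B t ω ∈ Set.Icc (0 : ℝ) 1) (hB' : Measurable B')
    (hB'01 : ∀ ω, B' ω ∈ Set.Icc (0 : ℝ) 1) (hBB' : ∀ t < T, ∀ ω, B t ω ≤ B' ω)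
    (hZB : ∫ ω, Z ω * B' ω ∂P ≤ δ) :
    ∑ t ∈ Finset.range T, ∫ ω, posterior P (F t) A ω *
      (v t ω * B t ω * posterior P (F t) Z ω * l t ω) ∂P ≤ γ⁻¹ * (L + 1) * (2 * √(2 * δ)) := by
  set O : ℕ → Ω → ℝ := fun t ω => ∑ s ∈ Finset.range t, X s ω * l s ω with hO_def
  have hO : ∀ t, BddMeas (F t) (O t) := fun t => by
    simpa only [one_mul] using h.bddMeas_sum (w := fun _ _ => 1) (fun _ => .const 1) t
  have hZB01 : ∀ ω, Z ω * B' ω ∈ Set.Icc (0 : ℝ) 1 := fun ω =>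
    ⟨mul_nonneg (hZ01 ω).1 (hB'01 ω).1, mul_le_one₀ (hZ01 ω).2 (hB'01 ω).1 (hB'01 ω).2⟩
  have hZBm : Measurable (fun ω => Z ω * B' ω) := hZ.mul hB'
  -- The maximal inequality is applied to Z·B' with regularization δ, giving √(E ZB' + δ) ≤ √(2δ).
  obtain ⟨S, hSb, hS0, hS, hSint⟩ :=
    exists_sqrt_posterior_le (P := P) h.F_mono h.F_le hZBm hZB01 hδ T
  have hlow : ∀ t, MeasurableSet[F t] {ω | O t ω ≤ L} := fun t =>
    measurableSet_le (hO t).meas measurable_const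
  have hhigh : ∀ t, BddMeas (F t) (fun ω => if L < O t ω then (1 : ℝ) else 0) := fun t =>
    .ite (measurableSet_lt measurable_const (hO t).meas) (.const 1) (.const 0)
  set f : ℕ → Ω → ℝ := fun t ω => v t ω * B t ω * posterior P (F t) Z ω * l t ω with hf_def
  have hf : ∀ t, BddMeas (G t) (f t) := fun t =>
    ((((hv t).mul (hB t)).mul bddMeas_posterior).mono (h.F_le_G t)).mul (h.bddMeas_l t t)
  have hf0 : ∀ t ω, 0 ≤ f t ω := fun t ω => mul_nonneg (mul_nonneg (mul_nonneg (hv0 t ω)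
    (hB01 t ω).1) (posterior_mem ω).1) (h.l_mem t ω).1
  have hflow : ∀ t, BddMeas (G t) (fun ω => if O t ω ≤ L then f t ω else 0) := fun t =>
    .ite (h.F_le_G t _ (hlow t)) (hf t) (.const 0)
  have hXlow : ∀ t, BddMeas mΩ (fun ω => if O t ω ≤ L then X t ω * l t ω else 0) := fun t =>
    .ite (h.F_le t _ (hlow t)) ((h.bddMeas_Xl t.lt_succ_self).mono (h.F_le _)) (.const 0)
  have step : ∀ t ∈ Finset.range T, ∫ ω, posterior P (F t) A ω * f t ω ∂P
      ≤ ∫ ω, γ⁻¹ * S ω * (if O t ω ≤ L then X t ω * l t ω else 0) ∂P := by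
    intro t ht
    have ht' : t < T := Finset.mem_range.1 ht
    have hp : BddMeas mΩ (posterior P (F t) A) := bddMeas_posterior.mono (h.F_le t)
    have b1 := hp.mul ((hflow t).mono (h.G_le t))
    have b2 := (hp.mul ((hhigh t).mono (h.F_le t))).const_mul γ⁻¹
    -- An optimal arm has total loss at most L, so its observed loss O never passes L; rounds with O
    -- > L contribute nothing.
    have hzero : ∫ ω, A ω * (if L < O t ω then (1 : ℝ) else 0) ∂P = 0 := by
      rw [integral_congr_ae (g := fun _ => (0 : ℝ)) (Filter.Eventually.of_forall fun ω => ?_),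
        integral_zero]
      beta_reduce
      by_cases hA : A ω = 0
      · rw [hA, zero_mul]
      · rw [if_neg, mul_zero]
        rw [not_lt]
        calc O t ω ≤ ∑ s ∈ Finset.range t, l s ω := Finset.sum_le_sum fun s _ =>
              mul_le_of_le_one_left (h.l_mem s ω).1 (h.X_mem s ω).2
          _ ≤ ∑ s ∈ Finset.range T, l s ω := Finset.sum_le_sum_of_subset_of_nonneg
              (Finset.range_subset_range.2 ht'.le) fun s _ _ => (h.l_mem s ω).1
          _ ≤ L := hL ω hA
    calc _ ≤ ∫ ω, (posterior P (F t) A ω * (if O t ω ≤ L then f t ω else 0)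
          + γ⁻¹ * (posterior P (F t) A ω * (if L < O t ω then (1 : ℝ) else 0))) ∂P := by
          refine integral_mono ((hp.mul ((hf t).mono (h.G_le t))).integrable le_rfl)
            ((b1.add b2).integrable le_rfl) fun ω => ?_
          have h1 := (posterior_mem (P := P) (m := F t) (Z := A) ω).1
          beta_reduce
          by_cases hc : O t ω ≤ L
          · simp [hc, not_lt.2 hc]
          · simp only [hc, if_false, not_le.1 hc, if_true, mul_zero, zero_add, mul_one]
            rw [mul_comm γ⁻¹]
            refine mul_le_mul_of_nonneg_left ?_ h1
            calc f t ω ≤ γ⁻¹ * 1 * 1 * 1 := by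
                  have h2 := hB01 t ω
                  have h3 := posterior_mem (P := P) (m := F t) (Z := Z) ω
                  have h4 := h.l_mem t ω
                  have h5 := hv0 t ω
                  have h6 : 0 ≤ γ⁻¹ := (inv_pos.2 hγ).le
                  exact mul_le_mul (mul_le_mul (mul_le_mul (hv1 t ω) h2.2 h2.1 h6) h3.2 h3.1
                    (by positivity)) h4.2 h4.1 (by positivity)
              _ = γ⁻¹ := by ring
      _ = ∫ ω, X t ω * (if O t ω ≤ L then f t ω else 0) ∂P := by
          rw [integral_add (b1.integrable le_rfl) (b2.integrable le_rfl),
            h.integral_X_mul ht' (hflow t), integral_const_mul,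
            integral_posterior_mul (h.F_le t) h.measurable_A h.A_mem (hhigh t), hzero]
          simp
      _ ≤ _ := by
          refine integral_mono_ae (((h.bddMeas_X t).mul ((hflow t).mono (h.G_le t))).integrable
            le_rfl) (((hSb.const_mul γ⁻¹).mul (hXlow t)).integrable le_rfl) ?_
          filter_upwards [posterior_mul_le (P := P) (h.F_le t) hZ hZBm hZ01 hZB01 (hB t)
            fun ω => mul_le_mul_of_nonneg_left (hBB' t ht' ω) (hZ01 ω).1] with ω hω
          split_ifs with hc
          · have h1 := posterior_mem (P := P) (m := F t) (Z := fun ω => Z ω * B' ω) ω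
            have h2 : posterior P (F t) Z ω * B t ω ≤ S ω := by
              refine hω.trans (le_trans ?_ (hS t ht'.le ω))
              -- For x in [0,1], x² ≤ x ≤ x + δ.
              refine Real.le_sqrt_of_sq_le ?_
              nlinarith [h1.1, h1.2]
            have h3 : v t ω * (posterior P (F t) Z ω * B t ω) ≤ γ⁻¹ * S ω :=
              mul_le_mul (hv1 t ω) h2 (mul_nonneg (posterior_mem ω).1 (hB01 t ω).1)
                (inv_pos.2 hγ).le
            calc X t ω * f t ω
                = v t ω * (posterior P (F t) Z ω * B t ω) * (X t ω * l t ω) := by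
                  simp only [hf_def]
                  ring
              _ ≤ _ := mul_le_mul_of_nonneg_right h3 (h.Xl_mem t ω).1
          · simp
  refine (Finset.sum_le_sum step).trans ?_
  rw [← integral_finsetSum _ fun t _ => ((hSb.const_mul γ⁻¹).mul (hXlow t)).integrable le_rfl]
  calc _ ≤ ∫ ω, γ⁻¹ * (L + 1) * S ω ∂P := by
        refine integral_mono ((BddMeas.sum _ fun t _ =>
          (hSb.const_mul γ⁻¹).mul (hXlow t)).integrable le_rfl)
          ((hSb.const_mul _).integrable le_rfl) fun ω => ?_
        beta_reduce
        rw [← Finset.mul_sum]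
        have := sum_capped_le (fun t => X t ω * l t ω) hL0 T (fun t _ => h.Xl_mem t ω)
          zero_le_one
        calc _ ≤ γ⁻¹ * S ω * (L + 1) := mul_le_mul_of_nonneg_left this
              (mul_nonneg (inv_pos.2 hγ).le (hS0 ω))
          _ = _ := by ring
    _ = γ⁻¹ * (L + 1) * ∫ ω, S ω ∂P := integral_const_mul _ _
    _ ≤ _ := by
        have h6 : 0 ≤ γ⁻¹ := (inv_pos.2 hγ).le
        refine mul_le_mul_of_nonneg_left (hSint.trans ?_) (by positivity)
        gcongr
        linarith

end ArmModel

/-! ### One arm: regret via the square-root potential, and the combined bound. -/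

/-- Young's inequality for the potential `√`. -/
theorem mul_sq_sub_sq_le {u y y' η : ℝ} (hu : 0 ≤ u) (hy : 0 < y) (hη : 0 < η) :
    u * (y ^ 2 - y' ^ 2) ≤ η * (u ^ 2 * y ^ 3) + η⁻¹ * (y - 2 * y' + y' ^ 2 * y⁻¹) := by
  -- Completing the square, using y² − y'² = 2y(y − y') − (y − y')²; the η⁻¹ term is (y − y')²/y.
  have h1 : η * (u ^ 2 * y ^ 3) + η⁻¹ * (y - 2 * y' + y' ^ 2 * y⁻¹) - u * (y ^ 2 - y' ^ 2)
      = (η * y)⁻¹ * (η * u * y ^ 2 - (y - y')) ^ 2 + u * (y - y') ^ 2 := by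
    field_simp
    ring
  have h2 : 0 ≤ (η * y)⁻¹ * (η * u * y ^ 2 - (y - y')) ^ 2 + u * (y - y') ^ 2 := by positivity
  linarith

namespace ArmModel

variable {Ω : Type*} {mΩ : MeasurableSpace Ω} {P : Measure Ω} {T : ℕ}
  {F G : ℕ → MeasurableSpace Ω} {X l : ℕ → Ω → ℝ} {A : Ω → ℝ} [IsProbabilityMeasure P]

/-- The regret in rounds in which the arm is played with large probability and its estimated
loss is still at most `D`. -/
theorem sum_integral_estimated_le (h : ArmModel P T F G X l A) {γ ε η D : ℝ}
    (hε : 0 < ε) (hεγ : ε ≤ γ) (hη : 0 < η) (hD : 0 ≤ D) {Z : Ω → ℝ}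
    (hZ : ∀ t, Measurable[G t] Z) (hZ01 : ∀ ω, Z ω ∈ Set.Icc (0 : ℝ) 1)
    (hZA : ∀ ω, Z ω ≤ A ω) {v : ℕ → Ω → ℝ} (hv : ∀ t, BddMeas (F t) (v t))
    (hvp : ∀ t ω, v t ω = 0 ∨ (γ ≤ posterior P (F t) A ω ∧ v t ω = (posterior P (F t) A ω)⁻¹))
    (hvD : ∀ ω, ∑ t ∈ Finset.range T, v t ω * (X t ω * l t ω) ≤ D) :
    ∑ t ∈ Finset.range T, ∫ ω, posterior P (F t) A ω *
      (v t ω * l t ω * (posterior P (F t) Z ω - Z ω)) ∂P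
      ≤ (4 * η * D + 2 * η⁻¹) * √(∫ ω, Z ω ∂P + ε) := by
  have hγ : 0 < γ := hε.trans_le hεγ
  have hZm : Measurable Z := (hZ 0).mono (h.G_le 0) le_rfl
  have hv0 : ∀ t ω, 0 ≤ v t ω := fun t ω => by
    rcases hvp t ω with e | ⟨_, e⟩
    · rw [e]
    · rw [e]
      exact inv_nonneg.2 (posterior_mem ω).1
  set q : ℕ → Ω → ℝ := fun t => posterior P (F t) Z with hq_def
  set y : ℕ → Ω → ℝ := fun t ω => √(q t ω + ε) with hy_def
  set u : ℕ → Ω → ℝ := fun t ω => v t ω * (X t ω * l t ω) with hu_def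
  have hq : ∀ t, BddMeas (F t) (q t) := fun t => bddMeas_posterior
  have hqε : ∀ t ω, ε ≤ q t ω + ε := fun t ω => le_add_of_nonneg_left (posterior_mem ω).1
  have hqε0 : ∀ t ω, 0 < q t ω + ε := fun t ω => hε.trans_le (hqε t ω)
  have hy : ∀ t, BddMeas (F t) (y t) := fun t => ((hq t).add (.const ε)).sqrt
  have hysq : ∀ t ω, y t ω ^ 2 = q t ω + ε := fun t ω => Real.sq_sqrt (hqε0 t ω).le
  have hy0 : ∀ t ω, 0 < y t ω := fun t ω => Real.sqrt_pos.2 (hqε0 t ω)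
  have hyinv : ∀ t, BddMeas (F t) (fun ω => (y t ω)⁻¹) := fun t =>
    (hy t).inv (Real.sqrt_pos.2 hε) fun ω => Real.sqrt_le_sqrt (hqε t ω)
  have hu : ∀ t, BddMeas (F (t + 1)) (u t) := fun t =>
    ((hv t).mono (h.F_mono t.le_succ)).mul (h.bddMeas_Xl t.lt_succ_self)
  have hu0 : ∀ t ω, 0 ≤ u t ω := fun t ω => mul_nonneg (hv0 t ω) (h.Xl_mem t ω).1
  have amb : ∀ {t} {f : Ω → ℝ}, BddMeas (F t) f → BddMeas mΩ f := fun hf => hf.mono (h.F_le _)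
  have hZb : BddMeas mΩ Z := .of_mem_Icc hZm hZ01
  obtain ⟨S, hSb, hS0, hS, hSint⟩ :=
    exists_sqrt_posterior_le (P := P) h.F_mono h.F_le hZm hZ01 hε T
  have step : ∀ t ∈ Finset.range T, ∫ ω, posterior P (F t) A ω *
      (v t ω * l t ω * (q t ω - Z ω)) ∂P
      ≤ 2 * η * ∫ ω, u t ω * S ω ∂P
        + 2 * η⁻¹ * (∫ ω, y t ω ∂P - ∫ ω, y (t + 1) ω ∂P) := by
    intro t ht
    have ht' : t < T := Finset.mem_range.1 ht
    have bq : BddMeas (G t) (fun ω => v t ω * l t ω * (q t ω - Z ω)) :=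
      (((hv t).mono (h.F_le_G t)).mul (h.bddMeas_l t t)).mul
        (((hq t).mono (h.F_le_G t)).sub (.of_mem_Icc (hZ t) hZ01))
    have b1 : BddMeas mΩ (fun ω => u t ω * q t ω) := (amb (hu t)).mul (amb (hq t))
    have b2 : BddMeas mΩ (fun ω => u t ω * Z ω) := (amb (hu t)).mul hZb
    have b3 : BddMeas mΩ (fun ω => q (t + 1) ω * u t ω) := (amb (hq _)).mul (amb (hu t))
    have b4 : BddMeas mΩ (fun ω => y (t + 1) ω ^ 2 * (y t ω)⁻¹) := by
      simp only [hysq]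
      exact ((amb (hq _)).add (.const ε)).mul (amb (hyinv t))
    -- y² is a martingale and 1/y_t is known at time t. Hence the η⁻¹ term of Young's inequality
    -- integrates to 2(E y_t − E y_{t+1}), which telescopes.
    have hcond : ∫ ω, y (t + 1) ω ^ 2 * (y t ω)⁻¹ ∂P = ∫ ω, y t ω ∂P := by
      have e : ∀ k, t ≤ k → ∫ ω, y k ω ^ 2 * (y t ω)⁻¹ ∂P
          = ∫ ω, Z ω * (y t ω)⁻¹ ∂P + ∫ ω, ε * (y t ω)⁻¹ ∂P := fun k hk => by
        rw [← integral_posterior_mul (h.F_le k) hZm hZ01 ((hyinv t).mono (h.F_mono hk)),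
          ← integral_add (((amb (hq k)).mul (amb (hyinv t))).integrable le_rfl)
          (((amb (hyinv t)).const_mul ε).integrable le_rfl)]
        refine integral_congr_ae (Filter.Eventually.of_forall fun ω => ?_)
        beta_reduce
        rw [hysq, add_mul]
      rw [e (t + 1) t.le_succ, ← e t le_rfl]
      refine integral_congr_ae (Filter.Eventually.of_forall fun ω => ?_)
      have := hy0 t ω
      field_simp
    have b5 : BddMeas mΩ (fun ω => y t ω - 2 * y (t + 1) ω) :=
      (amb (hy t)).sub ((amb (hy _)).const_mul 2)
    have b6 : BddMeas mΩ (fun ω => 2 * η * (u t ω * S ω)) :=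
      ((amb (hu t)).mul hSb).const_mul _
    calc _ = ∫ ω, (u t ω * q t ω - u t ω * Z ω) ∂P := by
          rw [← h.integral_X_mul ht' bq]
          refine integral_congr_ae (Filter.Eventually.of_forall fun ω => ?_)
          simp only [hu_def]
          ring
      -- The estimate u_t is known before round t+1, so Z may be replaced by its next posterior.
      _ = ∫ ω, (u t ω * q t ω - q (t + 1) ω * u t ω) ∂P := by
          rw [integral_sub (b1.integrable le_rfl) (b2.integrable le_rfl),
            integral_sub (b1.integrable le_rfl) (b3.integrable le_rfl),
            integral_posterior_mul (h.F_le _) hZm hZ01 (hu t)]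
          congr 1
          exact integral_congr_ae (Filter.Eventually.of_forall fun ω => mul_comm _ _)
      _ ≤ ∫ ω, (2 * η * (u t ω * S ω)
            + η⁻¹ * (y t ω - 2 * y (t + 1) ω + y (t + 1) ω ^ 2 * (y t ω)⁻¹)) ∂P := by
          refine integral_mono_ae ((b1.sub b3).integrable le_rfl)
            ((b6.add ((b5.add b4).const_mul _)).integrable le_rfl) ?_
          filter_upwards [posterior_mono (P := P) (m := F t) hZm h.measurable_A hZ01 h.A_mem hZA]
            with ω hω
          have h1 := mul_sq_sub_sq_le (y' := y (t + 1) ω) (hu0 t ω) (hy0 t ω) hη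
          have h2 : u t ω ^ 2 * y t ω ^ 3 ≤ 2 * (u t ω * S ω) := by
            have h3 : u t ω ≤ v t ω := mul_le_of_le_one_right (hv0 t ω) (h.Xl_mem t ω).2
            -- If v = 1/p, this is (q + ε)/p, where q ≤ p because Z ≤ A, and ε ≤ γ ≤ p.
            have h4 : v t ω * y t ω ^ 2 ≤ 2 := by
              rcases hvp t ω with e | ⟨e1, e2⟩
              · rw [e, zero_mul]
                exact zero_le_two
              · have hp := hγ.trans_le e1
                rw [e2, hysq, inv_mul_le_iff₀ hp]
                have : q t ω ≤ posterior P (F t) A ω := hω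
                linarith
            have h5 : y t ω ≤ S ω := hS t ht'.le ω
            calc u t ω ^ 2 * y t ω ^ 3 = u t ω * (u t ω * y t ω ^ 2) * y t ω := by ring
              _ ≤ u t ω * (v t ω * y t ω ^ 2) * y t ω :=
                  mul_le_mul_of_nonneg_right (mul_le_mul_of_nonneg_left
                    (mul_le_mul_of_nonneg_right h3 (sq_nonneg _)) (hu0 t ω)) (hy0 t ω).le
              _ ≤ u t ω * 2 * y t ω :=
                  mul_le_mul_of_nonneg_right (mul_le_mul_of_nonneg_left h4 (hu0 t ω)) (hy0 t ω).le
              _ ≤ u t ω * 2 * S ω :=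
                  mul_le_mul_of_nonneg_left h5 (mul_nonneg (hu0 t ω) zero_le_two)
              _ = _ := by ring
          have h6 := mul_le_mul_of_nonneg_left h2 hη.le
          rw [hysq, hysq] at h1
          rw [hysq]
          linarith
      _ = _ := by
          rw [integral_add (b6.integrable le_rfl) (((b5.add b4).const_mul _).integrable le_rfl),
            integral_const_mul, integral_const_mul,
            integral_add (b5.integrable le_rfl) (b4.integrable le_rfl), hcond,
            integral_sub ((amb (hy t)).integrable le_rfl)
              (((amb (hy _)).const_mul 2).integrable le_rfl), integral_const_mul]
          ring
  have hZε : 0 < ∫ ω, Z ω ∂P + ε :=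
    add_pos_of_nonneg_of_pos (integral_nonneg fun ω => (hZ01 ω).1) hε
  have hy_init : ∫ ω, y 0 ω ∂P ≤ √(∫ ω, Z ω ∂P + ε) := by
    refine integral_sqrt_le (amb ((hq 0).add (.const ε))) hZε (fun ω => (hqε0 0 ω).le) ?_
    rw [integral_add ((amb (hq 0)).integrable le_rfl) (integrable_const _), hq_def,
      integral_posterior (h.F_le 0) hZm hZ01]
    simp
  have hy_last : 0 ≤ ∫ ω, y T ω ∂P := integral_nonneg fun ω => (hy0 T ω).le
  have hsum : ∑ t ∈ Finset.range T, ∫ ω, u t ω * S ω ∂P ≤ D * (2 * √(∫ ω, Z ω ∂P + ε)) := by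
    rw [← integral_finsetSum _ fun t _ => ((amb (hu t)).mul hSb).integrable le_rfl]
    calc _ ≤ ∫ ω, D * S ω ∂P := by
          refine integral_mono ((BddMeas.sum _ fun t _ => (amb (hu t)).mul hSb).integrable le_rfl)
            ((hSb.const_mul _).integrable le_rfl) fun ω => ?_
          beta_reduce
          rw [← Finset.sum_mul]
          exact mul_le_mul_of_nonneg_right (hvD ω) (hS0 ω)
      _ = D * ∫ ω, S ω ∂P := integral_const_mul _ _
      _ ≤ _ := mul_le_mul_of_nonneg_left hSint hD
  refine (Finset.sum_le_sum step).trans ?_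
  rw [Finset.sum_add_distrib, ← Finset.mul_sum, ← Finset.mul_sum, Finset.sum_range_sub']
  have hη' : 0 < η⁻¹ := inv_pos.2 hη
  calc _ ≤ 2 * η * (D * (2 * √(∫ ω, Z ω ∂P + ε))) + 2 * η⁻¹ * (√(∫ ω, Z ω ∂P + ε) - 0) := by
        gcongr
    _ = _ := by ring

/-- The posterior is additive. -/
theorem posterior_sum {m : MeasurableSpace Ω} (hm : m ≤ mΩ) {ι : Type*} (s : Finset ι)
    {Z : ι → Ω → ℝ} (hZ : ∀ k ∈ s, Measurable[mΩ] (Z k))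
    (hZ01 : ∀ k ∈ s, ∀ ω, Z k ω ∈ Set.Icc (0 : ℝ) 1) (hA : Measurable[mΩ] A)
    (hA01 : ∀ ω, A ω ∈ Set.Icc (0 : ℝ) 1) (hsum : ∀ ω, ∑ k ∈ s, Z k ω = A ω) :
    ∀ᵐ ω ∂P, ∑ k ∈ s, posterior P m (Z k) ω = posterior P m A ω := by
  have e : A = ∑ k ∈ s, Z k := by
    ext ω
    rw [Finset.sum_apply, hsum]
  have h1 : P[∑ k ∈ s, Z k|m] =ᵐ[P] ∑ k ∈ s, P[Z k|m] :=
    condExp_finsetSum (fun k hk =>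
      (BddMeas.of_mem_Icc (hZ k hk) (hZ01 k hk)).integrable le_rfl) m
  have h2 : ∀ᵐ ω ∂P, ∀ k ∈ s, posterior P m (Z k) ω = (P[Z k|m]) ω :=
    (Filter.eventually_all_finset s).2 fun k hk => posterior_ae_eq hm (hZ k hk) (hZ01 k hk)
  filter_upwards [h1, h2, posterior_ae_eq (P := P) hm hA hA01] with ω h1 h2 h3
  rw [h3, e, h1, Finset.sum_apply]
  exact Finset.sum_congr rfl h2

/-- The contribution of a single arm to the expected regret, when the event that the arm is
optimal is split into parts `Z k` on which its total loss is at most `Λ k`. -/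
theorem sum_integral_le (h : ArmModel P T F G X l A) {γ ε L : ℝ} (hε : 0 < ε) (hεγ : ε ≤ γ)
    (hL0 : 0 ≤ L) (hL : ∀ ω, A ω ≠ 0 → ∑ t ∈ Finset.range T, l t ω ≤ L)
    {ι : Type*} (s : Finset ι) {Z : ι → Ω → ℝ} {Λ θ η : ι → ℝ}
    (hZ : ∀ k ∈ s, ∀ t, Measurable[G t] (Z k))
    (hZ01 : ∀ k ∈ s, ∀ ω, Z k ω ∈ Set.Icc (0 : ℝ) 1) (hZA : ∀ ω, ∑ k ∈ s, Z k ω = A ω)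
    (hΛ : ∀ k ∈ s, ∀ ω, Z k ω ≠ 0 → ∑ t ∈ Finset.range T, l t ω ≤ Λ k)
    (hθ : ∀ k ∈ s, 0 ≤ θ k) (hη : ∀ k ∈ s, 0 < η k) :
    ∑ t ∈ Finset.range T, ∫ ω, (posterior P (F t) A ω - A ω) * l t ω ∂P
      ≤ 2 * γ * L + Real.log T + 2 + ∑ k ∈ s,
        ((4 * η k * (θ k + γ⁻¹) + 2 * (η k)⁻¹) * √(∫ ω, Z k ω ∂P + ε)
          + γ⁻¹ * (L + 1) * (2 * √(2 * Real.exp (2 * γ * Λ k - γ * θ k)))) := by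
  have hγ : 0 < γ := hε.trans_le hεγ
  have hγ' : 0 < γ⁻¹ := inv_pos.2 hγ
  have hZm : ∀ k ∈ s, Measurable (Z k) := fun k hk => (hZ k hk 0).mono (h.G_le 0) le_rfl
  set p : ℕ → Ω → ℝ := fun t => posterior P (F t) A with hp_def
  have hp : ∀ t, BddMeas (F t) (p t) := fun t => bddMeas_posterior
  have hp01 : ∀ t ω, p t ω ∈ Set.Icc (0 : ℝ) 1 := fun t ω => posterior_mem ω
  have amb : ∀ {t} {f : Ω → ℝ}, BddMeas (F t) f → BddMeas mΩ f := fun hf => hf.mono (h.F_le _)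
  -- The maximum does not change the value where γ ≤ p; it makes boundedness of the inverse hold
  -- everywhere.
  set v : ℕ → Ω → ℝ := fun t ω => if γ ≤ p t ω then (max γ (p t ω))⁻¹ else 0 with hv_def
  have hv : ∀ t, BddMeas (F t) (v t) := fun t =>
    .ite (measurableSet_le measurable_const (hp t).meas)
      (((BddMeas.const γ).max (hp t)).inv hγ fun ω => le_max_left _ _) (.const 0)
  have hvp : ∀ t ω, v t ω = 0 ∨ (γ ≤ p t ω ∧ v t ω = (p t ω)⁻¹) := fun t ω => by
    simp only [hv_def]
    split_ifs with hc
    · exact .inr ⟨hc, by rw [max_eq_right hc]⟩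
    · exact .inl rfl
  have hv0 : ∀ t ω, 0 ≤ v t ω := fun t ω => by
    rcases hvp t ω with e | ⟨_, e⟩ <;> rw [e]
    exact inv_nonneg.2 (hp01 t ω).1
  have hv1 : ∀ t ω, v t ω ≤ γ⁻¹ := fun t ω => by
    rcases hvp t ω with e | ⟨e, e'⟩
    · rw [e]
      exact hγ'.le
    · rw [e']
      exact inv_anti₀ hγ e
  have hpv : ∀ t ω, p t ω * v t ω ≤ 1 := fun t ω => by
    rcases hvp t ω with e | ⟨_, e'⟩
    · simp [e]
    · rw [e']
      exact mul_inv_le_one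
  have hγv : ∀ t ω, γ * v t ω ≤ 1 := fun t ω => by
    rw [← mul_inv_cancel₀ hγ.ne']
    exact mul_le_mul_of_nonneg_left (hv1 t ω) hγ.le
  set W : ℕ → Ω → ℝ := fun t ω => ∑ s ∈ Finset.range t, v s ω * (X s ω * l s ω) with hW_def
  have hW : ∀ t, BddMeas (F t) (W t) := h.bddMeas_sum hv
  have hWmono : ∀ t < T, ∀ ω, W t ω ≤ W T ω := fun t ht ω =>
    Finset.sum_le_sum_of_subset_of_nonneg (Finset.range_subset_range.2 ht.le)
      fun s _ _ => mul_nonneg (hv0 s ω) (h.Xl_mem s ω).1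
  set lo : ι → ℕ → Ω → ℝ := fun k t ω => if W t ω ≤ θ k then v t ω else 0 with hlo_def
  set hi : ι → ℕ → Ω → ℝ := fun k t ω => if θ k < W t ω then 1 else 0 with hhi_def
  have hlo : ∀ k t, BddMeas (F t) (lo k t) := fun k t =>
    .ite (measurableSet_le (hW t).meas measurable_const) (hv t) (.const 0)
  have hhi : ∀ k t, BddMeas (F t) (hi k t) := fun k t =>
    .ite (measurableSet_lt measurable_const (hW t).meas) (.const 1) (.const 0)
  have hhi01 : ∀ k t ω, hi k t ω ∈ Set.Icc (0 : ℝ) 1 := fun k t ω => by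
    simp only [hhi_def]
    split_ifs <;> simp
  have hl : ∀ t, BddMeas mΩ (l t) := fun t => (h.bddMeas_l t t).mono (h.G_le t)
  have hZb : ∀ k ∈ s, BddMeas mΩ (Z k) := fun k hk => .of_mem_Icc (hZm k hk) (hZ01 k hk)
  have bR : ∀ t, BddMeas mΩ (fun ω => p t ω * ((if p t ω < γ then 1 else 0) * l t ω)) := fun t =>
    (amb (hp t)).mul ((amb (.ite (measurableSet_lt (hp t).meas measurable_const) (.const 1)
      (.const 0))).mul (hl t))
  have bL : ∀ k ∈ s, ∀ t, BddMeas mΩ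
      (fun ω => p t ω * (lo k t ω * l t ω * (posterior P (F t) (Z k) ω - Z k ω))) :=
    fun k hk t => (amb (hp t)).mul (((amb (hlo k t)).mul (hl t)).mul
      ((amb bddMeas_posterior).sub (hZb k hk)))
  have bH : ∀ k t, BddMeas mΩ
      (fun ω => p t ω * (v t ω * hi k t ω * posterior P (F t) (Z k) ω * l t ω)) :=
    fun k t => (amb (hp t)).mul
      ((((amb (hv t)).mul (amb (hhi k t))).mul (amb bddMeas_posterior)).mul (hl t))
  -- Rounds with p < γ drop −A. Otherwise p v = 1 and the posterior splits over k; scales past their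
  -- threshold drop −Z_k.
  have step : ∀ t ∈ Finset.range T, ∫ ω, (p t ω - A ω) * l t ω ∂P
      ≤ ∫ ω, p t ω * ((if p t ω < γ then 1 else 0) * l t ω) ∂P + ∑ k ∈ s,
        (∫ ω, p t ω * (lo k t ω * l t ω * (posterior P (F t) (Z k) ω - Z k ω)) ∂P
          + ∫ ω, p t ω * (v t ω * hi k t ω * posterior P (F t) (Z k) ω * l t ω) ∂P) := by
    intro t ht
    have e : ∀ k ∈ s,
        ∫ ω, p t ω * (lo k t ω * l t ω * (posterior P (F t) (Z k) ω - Z k ω)) ∂P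
          + ∫ ω, p t ω * (v t ω * hi k t ω * posterior P (F t) (Z k) ω * l t ω) ∂P
        = ∫ ω, (p t ω * (lo k t ω * l t ω * (posterior P (F t) (Z k) ω - Z k ω))
          + p t ω * (v t ω * hi k t ω * posterior P (F t) (Z k) ω * l t ω)) ∂P := fun k hk =>
      (integral_add ((bL k hk t).integrable le_rfl) ((bH k t).integrable le_rfl)).symm
    rw [Finset.sum_congr rfl e, ← integral_finsetSum _ fun k hk =>
      ((bL k hk t).add (bH k t)).integrable le_rfl, ← integral_add ((bR t).integrable le_rfl)
      ((BddMeas.sum _ fun k hk => (bL k hk t).add (bH k t)).integrable le_rfl)]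
    refine integral_mono_ae ((((amb (hp t)).sub (.of_mem_Icc h.measurable_A h.A_mem)).mul
      (hl t)).integrable le_rfl) (((bR t).add (BddMeas.sum _ fun k hk =>
      (bL k hk t).add (bH k t))).integrable le_rfl) ?_
    filter_upwards [posterior_sum (P := P) (h.F_le t) s hZm hZ01 h.measurable_A h.A_mem hZA]
      with ω hω
    have hlω := h.l_mem t ω
    have hAω := h.A_mem ω
    by_cases hc : γ ≤ p t ω
    · have hpv1 : p t ω * v t ω = 1 := by
        have : 0 < p t ω := hγ.trans_le hc
        simp only [hv_def, hc, if_true, max_eq_right]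
        field_simp
      rw [if_neg (not_lt.2 hc), zero_mul, mul_zero, zero_add,
        show p t ω = ∑ k ∈ s, posterior P (F t) (Z k) ω from hω.symm, ← hZA ω,
        ← Finset.sum_sub_distrib, Finset.sum_mul, hω]
      refine Finset.sum_le_sum fun k hk => ?_
      have hq := posterior_mem (P := P) (m := F t) (Z := Z k) ω
      have hz := hZ01 k hk ω
      change _ ≤ p t ω * _ + p t ω * _
      by_cases hcW : W t ω ≤ θ k
      · simp only [hlo_def, hhi_def, hcW, if_true, not_lt.2 hcW, if_false]
        refine le_of_eq ?_
        calc _ = p t ω * v t ω * ((posterior P (F t) (Z k) ω - Z k ω) * l t ω) := by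
              rw [hpv1, one_mul]
          _ = _ := by ring
      · simp only [hlo_def, hhi_def, hcW, if_false, not_le.1 hcW, if_true]
        calc (posterior P (F t) (Z k) ω - Z k ω) * l t ω
            ≤ posterior P (F t) (Z k) ω * l t ω :=
              mul_le_mul_of_nonneg_right (sub_le_self _ hz.1) hlω.1
          _ = p t ω * v t ω * (posterior P (F t) (Z k) ω * l t ω) := by rw [hpv1, one_mul]
          _ = _ := by ring
    · have hv_zero : v t ω = 0 := by simp only [hv_def, hc, if_false]
      have hlo_zero : ∀ k, lo k t ω = 0 := fun k => by simp only [hlo_def, hv_zero, ite_self]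
      simp only [not_le.1 hc, if_true, hv_zero, hlo_zero, zero_mul, mul_zero, add_zero,
        Finset.sum_const_zero, one_mul]
      exact mul_le_mul_of_nonneg_right (sub_le_self _ hAω.1) hlω.1
  refine (Finset.sum_le_sum step).trans ?_
  rw [Finset.sum_add_distrib, Finset.sum_comm]
  refine add_le_add (h.sum_integral_rare_le hγ.le hL0 hL) (Finset.sum_le_sum fun k hk => ?_)
  rw [Finset.sum_add_distrib]
  have hZA' : ∀ ω, Z k ω ≤ A ω := fun ω => by
    rw [← hZA ω]
    exact Finset.single_le_sum (f := fun k => Z k ω) (fun j hj => (hZ01 j hj ω).1) hk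
  refine add_le_add ?_ ?_
  · refine h.sum_integral_estimated_le hε hεγ (hη k hk) (add_nonneg (hθ k hk) hγ'.le) (hZ k hk)
      (hZ01 k hk) hZA' (hlo k) (fun t ω => ?_) fun ω => ?_
    · simp only [hlo_def]
      split_ifs
      · exact hvp t ω
      · exact .inl rfl
    · have := sum_capped_le (fun t => v t ω * (X t ω * l t ω)) (hθ k hk) T (b := γ⁻¹)
        (fun t _ => ⟨mul_nonneg (hv0 t ω) (h.Xl_mem t ω).1, ?_⟩) hγ'.le
      · refine le_trans (Finset.sum_le_sum fun t _ => ?_) this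
        simp only [hlo_def, hW_def]
        split_ifs <;> simp
      · exact (mul_le_of_le_one_right (hv0 t ω) (h.Xl_mem t ω).2).trans (hv1 t ω)
  -- Partial estimates are monotone, so exceeding θ_k at any round implies exceeding it at time T.
  -- Chernoff with c = γ applies there, the compensator being at most Λ_k on Z_k since p v ≤ 1.
  · refine h.sum_integral_exceed_le hγ hL0 (Real.exp_pos _) hL (hZm k hk) (hZ01 k hk) hv hv0 hv1
      (hhi k) (hhi01 k) (B' := hi k T) (amb (hhi k T)).meas (hhi01 k T) (fun t ht ω => ?_)
      (h.integral_mul_exceed_le hv hγ.le hv0 hγv le_rfl (hZm k hk) (hZ01 k hk)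
        (fun ω hω => ?_) (θ k))
    · simp only [hhi_def]
      split_ifs with h1 h2
      · exact le_rfl
      · exact absurd (h1.trans_le (hWmono t ht ω)) h2
      · exact zero_le_one
      · exact le_rfl
    · refine le_trans (Finset.sum_le_sum fun t _ => ?_) (hΛ k hk ω hω)
      exact mul_le_of_le_one_left (h.l_mem t ω).1 (hpv t ω)

end ArmModel

/-! ### Reduction of Thompson sampling to single arms. -/

section model

variable {d T : ℕ}

/-- The loss of arm `i` in round `n`, truncated to `[0,1]`. -/
noncomputable def clippedLoss (i : Fin d) (n : ℕ) (x : LossSeq d T) : ℝ :=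
  if hn : n < T then max 0 (min 1 (x ⟨n, hn⟩ i)) else 0

theorem clippedLoss_mem (i : Fin d) (n : ℕ) (x : LossSeq d T) :
    clippedLoss i n x ∈ Set.Icc (0 : ℝ) 1 := by
  unfold clippedLoss
  split_ifs
  · exact ⟨le_max_left _ _, max_le zero_le_one (min_le_left _ _)⟩
  · simp

theorem clippedLoss_eq {x : LossSeq d T} {t : Fin T} {i : Fin d}
    (h : x t i ∈ Set.Icc (0 : ℝ) 1) : clippedLoss i t x = x t i := by
  simp only [clippedLoss, t.isLt, dif_pos]
  rw [min_eq_right h.2, max_eq_right h.1]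

theorem measurable_clippedLoss (i : Fin d) (n : ℕ) :
    Measurable (clippedLoss i n : LossSeq d T → ℝ) := by
  unfold clippedLoss
  split_ifs
  · fun_prop
  · exact measurable_const

/-- The indicator that arm `i` is played in round `n`. -/
noncomputable def played {Ω : Type*} (play : Fin T → Ω → Action d) (i : Fin d) (n : ℕ) (ω : Ω) :
    ℝ :=
  if hn : n < T then (if i ∈ play ⟨n, hn⟩ ω then 1 else 0) else 0

/-- The indicator that arm `i` belongs to the optimal action and has total loss at most `c`. -/
noncomputable def optimalWithin (best : LossSeq d T → Action d) (i : Fin d) (c : ℝ)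
    (x : LossSeq d T) : ℝ :=
  if i ∈ best x ∧ ∑ n ∈ Finset.range T, clippedLoss i n x ≤ c then 1 else 0

/-- `playerInfo`, indexed by natural numbers. -/
@[reducible] def pastInfo {Ω : Type*} (loss : Ω → LossSeq d T) (play : Fin T → Ω → Action d)
    (n : ℕ) : MeasurableSpace Ω :=
  ⨆ s : Fin T, ⨆ _ : s.val < n,
    MeasurableSpace.comap (play s) ⊤ ⊔
      MeasurableSpace.comap (fun ω => feedback (loss ω s) (play s ω)) inferInstance

/-- `fullInfo`, indexed by natural numbers. -/
@[reducible] def pastFullInfo {Ω : Type*} (loss : Ω → LossSeq d T)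
    (play : Fin T → Ω → Action d) (n : ℕ) : MeasurableSpace Ω :=
  MeasurableSpace.comap loss inferInstance ⊔
    ⨆ s : Fin T, ⨆ _ : s.val < n, MeasurableSpace.comap (play s) ⊤

theorem optimalWithin_mem (best : LossSeq d T → Action d) (i : Fin d) (c : ℝ)
    (x : LossSeq d T) : optimalWithin best i c x ∈ Set.Icc (0 : ℝ) 1 := by
  unfold optimalWithin
  split_ifs <;> simp

theorem optimalWithin_mono (best : LossSeq d T → Action d) (i : Fin d) {c c' : ℝ} (h : c ≤ c')
    (x : LossSeq d T) : optimalWithin best i c x ≤ optimalWithin best i c' x := by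
  unfold optimalWithin
  split_ifs with h1 h2 h2
  · exact le_rfl
  · exact absurd ⟨h1.1, h1.2.trans h⟩ h2
  · exact zero_le_one
  · exact le_rfl

theorem le_of_optimalWithin_ne_zero {best : LossSeq d T → Action d} {i : Fin d} {c : ℝ}
    {x : LossSeq d T} (h : optimalWithin best i c x ≠ 0) :
    ∑ n ∈ Finset.range T, clippedLoss i n x ≤ c := by
  unfold optimalWithin at h
  split_ifs at h with h1
  · exact h1.2
  · exact absurd rfl h

theorem IsBestActionRule.measurable_optimalWithin {𝒜 : Finset (Action d)}
    {best : LossSeq d T → Action d} (hb : IsBestActionRule 𝒜 best) (i : Fin d) (c : ℝ) :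
    Measurable (optimalWithin best i c) := by
  have h1 : MeasurableSet {x | i ∈ best x} := by
    have : {x | i ∈ best x} = ⋃ B : Action d, ⋃ _ : i ∈ B, {x | best x = B} := by
      ext x
      simp
    rw [this]
    exact .iUnion fun B => .iUnion fun _ => hb.measurableSet_fiber B
  have h2 : MeasurableSet {x : LossSeq d T | ∑ n ∈ Finset.range T, clippedLoss i n x ≤ c} :=
    measurableSet_le (Finset.measurable_sum _ fun n _ => measurable_clippedLoss i n)
      measurable_const
  exact Measurable.ite (h1.inter h2) measurable_const measurable_const

/-- The best loss is the sum of the losses of the arms of the optimal action. -/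
theorem IsBestActionRule.bestLoss_eq {𝒜 : Finset (Action d)} (h𝒜 : 𝒜.Nonempty)
    {best : LossSeq d T → Action d} (hb : IsBestActionRule 𝒜 best) {x : LossSeq d T}
    (hx : ∀ t i, x t i ∈ Set.Icc (0 : ℝ) 1) :
    bestLoss 𝒜 h𝒜 x = ∑ i ∈ best x, ∑ n ∈ Finset.range T, clippedLoss i n x := by
  have h1 : bestLoss 𝒜 h𝒜 x = totalLoss x (best x) :=
    le_antisymm (Finset.inf'_le _ (hb.mem x)) (Finset.le_inf' _ _ fun B hB => hb.le x B hB)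
  rw [h1, totalLoss, Finset.sum_comm]
  refine Finset.sum_congr rfl fun i _ => ?_
  rw [Finset.sum_range]
  exact Finset.sum_congr rfl fun t _ => (clippedLoss_eq (hx t i)).symm

/-- Losses are nonnegative, so each optimal arm loses at most the best loss and the cap L is vacuous
here. The cap is kept so that the loss bound on an optimal arm holds everywhere, not just almost
surely. -/
theorem IsBestActionRule.optimalWithin_eq {𝒜 : Finset (Action d)} (h𝒜 : 𝒜.Nonempty)
    {best : LossSeq d T → Action d} (hb : IsBestActionRule 𝒜 best) {x : LossSeq d T}
    (hx : ∀ t i, x t i ∈ Set.Icc (0 : ℝ) 1) {L : ℝ} (hL : bestLoss 𝒜 h𝒜 x ≤ L) (i : Fin d) :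
    optimalWithin best i L x = if i ∈ best x then 1 else 0 := by
  unfold optimalWithin
  by_cases hi : i ∈ best x
  · rw [if_pos hi, if_pos]
    refine ⟨hi, le_trans ?_ hL⟩
    rw [hb.bestLoss_eq h𝒜 hx]
    exact Finset.single_le_sum (f := fun i => ∑ n ∈ Finset.range T, clippedLoss i n x)
      (fun j _ => Finset.sum_nonneg fun n _ => (clippedLoss_mem j n x).1) hi
  · simp [hi]

theorem IsBestActionRule.regret_eq {𝒜 : Finset (Action d)} (h𝒜 : 𝒜.Nonempty) {Ω : Type*}
    {best : LossSeq d T → Action d} (hb : IsBestActionRule 𝒜 best) {loss : Ω → LossSeq d T}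
    (play : Fin T → Ω → Action d) {ω : Ω} (hx : ∀ t i, loss ω t i ∈ Set.Icc (0 : ℝ) 1) {L : ℝ}
    (hL : bestLoss 𝒜 h𝒜 (loss ω) ≤ L) :
    regret 𝒜 h𝒜 (loss ω) (fun t => play t ω) = ∑ i, ∑ n ∈ Finset.range T,
      (played play i n ω - optimalWithin best i L (loss ω)) * clippedLoss i n (loss ω) := by
  simp only [sub_mul, Finset.sum_sub_distrib]
  rw [regret, hb.bestLoss_eq h𝒜 hx]
  congr 1
  · rw [Finset.sum_comm, Finset.sum_range]
    refine Finset.sum_congr rfl fun t _ => ?_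
    simp only [played, t.isLt, dif_pos, ite_mul, one_mul, zero_mul, Fin.eta]
    rw [Finset.sum_ite_mem, Finset.univ_inter]
    exact Finset.sum_congr rfl fun i _ => (clippedLoss_eq (hx t i)).symm
  · simp only [hb.optimalWithin_eq h𝒜 hx hL, ← Finset.mul_sum]
    simp only [ite_mul, one_mul, zero_mul]
    rw [Finset.sum_ite_mem, Finset.univ_inter]

variable {Ω : Type*} {loss : Ω → LossSeq d T} {play : Fin T → Ω → Action d}

theorem measurableSet_mem_play {m : MeasurableSpace Ω} {s : Fin T}
    (h : MeasurableSpace.comap (play s) ⊤ ≤ m) (i : Fin d) :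
    MeasurableSet[m] {ω | i ∈ play s ω} :=
  h _ ⟨{B | i ∈ B}, trivial, rfl⟩

theorem comap_play_le_pastInfo {s : Fin T} {n : ℕ} (h : s.val < n) :
    MeasurableSpace.comap (play s) ⊤ ≤ pastInfo loss play n :=
  le_trans le_sup_left (le_iSup₂_of_le s h le_rfl)

theorem comap_feedback_le_pastInfo {s : Fin T} {n : ℕ} (h : s.val < n) :
    MeasurableSpace.comap (fun ω => feedback (loss ω s) (play s ω)) inferInstance
      ≤ pastInfo loss play n :=
  le_trans le_sup_right (le_iSup₂_of_le s h le_rfl)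

/-- Feedback is a function of the loss sequence and the action played. -/
theorem pastInfo_le_pastFullInfo (n : ℕ) : pastInfo loss play n ≤ pastFullInfo loss play n := by
  refine iSup₂_le fun s hs => ?_
  have h1 : MeasurableSpace.comap (play s) ⊤ ≤ pastFullInfo loss play n :=
    le_trans (le_iSup₂_of_le (f := fun (s : Fin T) (_ : s.val < n) =>
      MeasurableSpace.comap (play s) ⊤) s hs le_rfl) le_sup_right
  refine sup_le h1 ?_
  have h2 : Measurable[pastFullInfo loss play n] loss :=
    (comap_measurable loss).mono le_sup_left le_rfl
  have h3 : Measurable[pastFullInfo loss play n]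
      (fun ω => feedback (loss ω s) (play s ω)) := by
    refine @measurable_pi_lambda _ _ _ (pastFullInfo loss play n) _ _ fun i => ?_
    exact Measurable.ite (measurableSet_mem_play h1 i)
      ((measurable_pi_apply i).comp ((measurable_pi_apply s).comp h2)) measurable_const
  exact h3.comap_le

variable {mΩ : MeasurableSpace Ω} {P : Measure Ω} {𝒜 : Finset (Action d)}
  {best : LossSeq d T → Action d}

theorem IsThompsonSampling.comap_play_le (hp : IsThompsonSampling P best loss play)
    (s : Fin T) : MeasurableSpace.comap (play s) ⊤ ≤ mΩ := by
  rintro _ ⟨S, -, rfl⟩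
  have : play s ⁻¹' S = ⋃ B : Action d, ⋃ _ : B ∈ S, {ω | play s ω = B} := by
    ext ω
    simp
  rw [this]
  exact .iUnion fun B => .iUnion fun _ => hp.measurableSet_fiber s B

theorem IsThompsonSampling.pastFullInfo_le (hp : IsThompsonSampling P best loss play)
    (hloss : Measurable loss) (n : ℕ) : pastFullInfo loss play n ≤ mΩ :=
  sup_le hloss.comap_le (iSup₂_le fun s _ => hp.comap_play_le s)

variable [IsProbabilityMeasure P]

/-- The sampling law for whole actions is summed over the actions containing the arm. -/
theorem IsThompsonSampling.condExp_played (hp : IsThompsonSampling P best loss play)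
    (hloss : Measurable loss) (hb : IsBestActionRule 𝒜 best) (i : Fin d) (t : Fin T) :
    P[played play i t|pastFullInfo loss play t]
      =ᵐ[P] P[fun ω => if i ∈ best (loss ω) then (1 : ℝ) else 0|pastInfo loss play t] := by
  have key : ∀ a : Ω → Action d, (fun ω => if i ∈ a ω then (1 : ℝ) else 0)
      = ∑ B ∈ Finset.univ.filter (fun B : Action d => i ∈ B),
        {ω | a ω = B}.indicator (fun _ => (1 : ℝ)) := fun a => by
    ext ω
    simp [Finset.sum_apply, Set.indicator_apply, Finset.sum_ite_eq]
  have e1 : played play i t = fun ω => if i ∈ play t ω then (1 : ℝ) else 0 := by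
    ext ω
    simp [played]
  rw [e1, key, key]
  have i1 : ∀ B : Action d, Integrable ({ω | play t ω = B}.indicator (fun _ => (1 : ℝ))) P :=
    fun B => (integrable_const _).indicator (hp.measurableSet_fiber t B)
  have i2 : ∀ B : Action d,
      Integrable ({ω | best (loss ω) = B}.indicator (fun _ => (1 : ℝ))) P :=
    fun B => (integrable_const _).indicator (hloss (hb.measurableSet_fiber B))
  refine (condExp_finsetSum (fun B _ => i1 B) _).trans
    (Filter.EventuallyEq.trans ?_ (condExp_finsetSum (fun B _ => i2 B) _).symm)
  have h : ∀ᵐ ω ∂P, ∀ B : Action d,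
      (P⟦{ω | play t ω = B} | pastFullInfo loss play t⟧) ω
        = (P⟦{ω | best (loss ω) = B} | pastInfo loss play t⟧) ω :=
    ae_all_iff.2 fun B => hp.law t B
  filter_upwards [h] with ω hω
  simp only [Finset.sum_apply]
  exact Finset.sum_congr rfl fun B _ => hω B

/-- Every arm of Thompson sampling with semi-bandit feedback is an `ArmModel`. -/
theorem IsThompsonSampling.armModel (hp : IsThompsonSampling P best loss play)
    (hloss : Measurable loss) (h01 : ∀ᵐ ω ∂P, ∀ t i, loss ω t i ∈ Set.Icc (0 : ℝ) 1)
    (h𝒜 : 𝒜.Nonempty) (hb : IsBestActionRule 𝒜 best) {L : ℝ}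
    (hL : ∀ᵐ ω ∂P, bestLoss 𝒜 h𝒜 (loss ω) ≤ L) (i : Fin d) :
    ArmModel P T (pastInfo loss play) (pastFullInfo loss play) (played play i)
      (fun n ω => clippedLoss i n (loss ω)) (fun ω => optimalWithin best i L (loss ω)) where
  F_mono n n' h := iSup₂_le fun s hs => sup_le (comap_play_le_pastInfo (hs.trans_le h))
    (comap_feedback_le_pastInfo (hs.trans_le h))
  F_le_G := pastInfo_le_pastFullInfo
  G_le := hp.pastFullInfo_le hloss
  X_eq n ω := by
    unfold played
    split_ifs <;> simp
  l_mem n ω := clippedLoss_mem i n _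
  A_mem ω := optimalWithin_mem _ _ _ _
  measurable_X n := by
    unfold played
    split_ifs with hn
    · exact Measurable.ite (measurableSet_mem_play (hp.comap_play_le _) i) measurable_const
        measurable_const
    · exact measurable_const
  measurable_Xl n := by
    by_cases hn : n < T
    · have e : (fun ω => played play i n ω * clippedLoss i n (loss ω))
          = fun ω => max 0 (min 1 (feedback (loss ω ⟨n, hn⟩) (play ⟨n, hn⟩ ω) i)) := by
        ext ω
        simp only [played, clippedLoss, feedback, hn, dif_pos]
        split_ifs <;> simp
      have h1 : Measurable[pastInfo loss play (n + 1)]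
          (fun ω => feedback (loss ω ⟨n, hn⟩) (play ⟨n, hn⟩ ω)) :=
        (comap_measurable _).mono (comap_feedback_le_pastInfo n.lt_succ_self) le_rfl
      rw [e]
      exact (measurable_const (a := (0 : ℝ))).max ((measurable_const (a := (1 : ℝ))).min
        ((measurable_pi_apply i).comp h1))
    · simp only [played, hn, dif_neg, not_false_eq_true, zero_mul]
      exact measurable_const
  measurable_l s t := (measurable_clippedLoss i s).comp
    ((comap_measurable loss).mono le_sup_left le_rfl)
  measurable_A := (hb.measurable_optimalWithin i L).comp hloss
  condExp_X t ht := by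
    refine (hp.condExp_played hloss hb i ⟨t, ht⟩).trans (condExp_congr_ae ?_)
    filter_upwards [h01, hL] with ω h1 h2
    exact (hb.optimalWithin_eq h𝒜 h1 h2 i).symm

/-- The expected regret, as a sum over arms. -/
theorem IsThompsonSampling.integral_regret (hp : IsThompsonSampling P best loss play)
    (hloss : Measurable loss) (h01 : ∀ᵐ ω ∂P, ∀ t i, loss ω t i ∈ Set.Icc (0 : ℝ) 1)
    (h𝒜 : 𝒜.Nonempty) (hb : IsBestActionRule 𝒜 best) {L : ℝ}
    (hL : ∀ᵐ ω ∂P, bestLoss 𝒜 h𝒜 (loss ω) ≤ L) :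
    ∫ ω, regret 𝒜 h𝒜 (loss ω) (fun t => play t ω) ∂P
      = ∑ i, ∑ n ∈ Finset.range T, ∫ ω,
        (posterior P (pastInfo loss play n) (fun ω => optimalWithin best i L (loss ω)) ω
          - optimalWithin best i L (loss ω)) * clippedLoss i n (loss ω) ∂P := by
  have hm := hp.armModel hloss h01 h𝒜 hb hL
  have hA : ∀ i, BddMeas mΩ (fun ω => optimalWithin best i L (loss ω)) := fun i =>
    .of_mem_Icc (hm i).measurable_A (hm i).A_mem
  have hl : ∀ i n, BddMeas mΩ (fun ω => clippedLoss i n (loss ω)) := fun i n =>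
    ((hm i).bddMeas_l n n).mono ((hm i).G_le n)
  have hterm : ∀ i n, BddMeas mΩ (fun ω =>
      (played play i n ω - optimalWithin best i L (loss ω)) * clippedLoss i n (loss ω)) :=
    fun i n => (((hm i).bddMeas_X n).sub (hA i)).mul (hl i n)
  rw [integral_congr_ae (g := fun ω => ∑ i, ∑ n ∈ Finset.range T,
      (played play i n ω - optimalWithin best i L (loss ω)) * clippedLoss i n (loss ω))
    (by filter_upwards [h01, hL] with ω h1 h2 using hb.regret_eq h𝒜 play h1 h2),
    integral_finsetSum _ fun i _ => (BddMeas.sum _ fun n _ => hterm i n).integrable le_rfl]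
  refine Finset.sum_congr rfl fun i _ => ?_
  rw [integral_finsetSum _ fun n _ => (hterm i n).integrable le_rfl]
  refine Finset.sum_congr rfl fun n hn => ?_
  simp only [sub_mul]
  have bA := ((hA i).mul (hl i n)).integrable (P := P) le_rfl
  rw [integral_sub (((hm i).bddMeas_X n |>.mul (hl i n)).integrable le_rfl) bA,
    integral_sub (((bddMeas_posterior.mono ((hm i).F_le n)).mul (hl i n)).integrable le_rfl) bA,
    (hm i).integral_X_mul (Finset.mem_range.1 hn) ((hm i).bddMeas_l n n)]

end model

/-! ### Dyadic decomposition of the loss of an optimal arm. -/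

section scales

variable {d T : ℕ}

/-- The indicator that arm `i` belongs to the optimal action and that its total loss lies in
`(L / 2 ^ (k + 1), L / 2 ^ k]`, or in `[0, L / 2 ^ K]` for the last scale `k = K`. -/
noncomputable def optimalAtScale (best : LossSeq d T → Action d) (L : ℝ) (K : ℕ) (i : Fin d)
    (k : ℕ) (x : LossSeq d T) : ℝ :=
  optimalWithin best i (L / 2 ^ k) x
    - if k < K then optimalWithin best i (L / 2 ^ (k + 1)) x else 0

variable {best : LossSeq d T → Action d} {L : ℝ} {K : ℕ}

theorem sum_optimalAtScale (i : Fin d) (x : LossSeq d T) :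
    ∑ k ∈ Finset.range (K + 1), optimalAtScale best L K i k x = optimalWithin best i L x := by
  rw [Finset.sum_range_succ, Finset.sum_congr rfl (g := fun k =>
    optimalWithin best i (L / 2 ^ k) x - optimalWithin best i (L / 2 ^ (k + 1)) x)
    fun k hk => by rw [optimalAtScale, if_pos (Finset.mem_range.1 hk)], Finset.sum_range_sub']
  simp [optimalAtScale]

theorem optimalAtScale_le (i : Fin d) (k : ℕ) (x : LossSeq d T) :
    optimalAtScale best L K i k x ≤ optimalWithin best i (L / 2 ^ k) x := by
  unfold optimalAtScale
  split_ifs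
  · exact sub_le_self _ (optimalWithin_mem _ _ _ _).1
  · rw [sub_zero]

theorem optimalAtScale_mem (hL : 0 ≤ L) (i : Fin d) (k : ℕ) (x : LossSeq d T) :
    optimalAtScale best L K i k x ∈ Set.Icc (0 : ℝ) 1 := by
  refine ⟨?_, (optimalAtScale_le i k x).trans (optimalWithin_mem _ _ _ _).2⟩
  unfold optimalAtScale
  split_ifs
  · refine sub_nonneg.2 (optimalWithin_mono best i ?_ x)
    exact div_le_div_of_nonneg_left hL (by positivity)
      (pow_le_pow_right₀ one_le_two k.le_succ)
  · rw [sub_zero]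
    exact (optimalWithin_mem _ _ _ _).1

theorem le_of_optimalAtScale_ne_zero (hL : 0 ≤ L) {i : Fin d} {k : ℕ} {x : LossSeq d T}
    (h : optimalAtScale best L K i k x ≠ 0) :
    ∑ n ∈ Finset.range T, clippedLoss i n x ≤ L / 2 ^ k :=
  le_of_optimalWithin_ne_zero (best := best) fun h0 => h <|
    le_antisymm ((optimalAtScale_le i k x).trans h0.le) (optimalAtScale_mem hL i k x).1

theorem IsBestActionRule.measurable_optimalAtScale {𝒜 : Finset (Action d)}
    (hb : IsBestActionRule 𝒜 best) (i : Fin d) (k : ℕ) :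
    Measurable (optimalAtScale best L K i k) := by
  unfold optimalAtScale
  split_ifs
  · exact (hb.measurable_optimalWithin i _).sub (hb.measurable_optimalWithin i _)
  · exact (hb.measurable_optimalWithin i _).sub measurable_const

/-- Few arms of the optimal action have a large total loss. -/
theorem IsBestActionRule.sum_optimalAtScale_le {𝒜 : Finset (Action d)} (h𝒜 : 𝒜.Nonempty)
    (hb : IsBestActionRule 𝒜 best) {m : ℕ} (hm : ∀ B ∈ 𝒜, B.card = m) (hmK : m ≤ 2 ^ K)
    (hL0 : 0 < L) {x : LossSeq d T} (hx : ∀ t i, x t i ∈ Set.Icc (0 : ℝ) 1)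
    (hL : bestLoss 𝒜 h𝒜 x ≤ L) {k : ℕ} (hk : k ≤ K) :
    ∑ i, optimalAtScale best L K i k x ≤ 2 ^ (k + 1) := by
  have hout : ∀ i ∉ best x, optimalAtScale best L K i k x = 0 := fun i hi => by
    simp [optimalAtScale, optimalWithin, hi]
  rw [← Finset.sum_subset (Finset.subset_univ (best x)) fun i _ hi => hout i hi]
  rcases hk.lt_or_eq with h | rfl
  -- Markov counting: an arm counted at scale k < K loses more than L/2^(k+1), and the optimal arms
  -- together lose at most L. At k = K there is no lower bound, and the cardinality m is used
  -- instead.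
  · calc _ ≤ ∑ i ∈ best x, 2 ^ (k + 1) / L * ∑ n ∈ Finset.range T, clippedLoss i n x := by
          refine Finset.sum_le_sum fun i hi => ?_
          have h0 : 0 ≤ ∑ n ∈ Finset.range T, clippedLoss i n x :=
            Finset.sum_nonneg fun n _ => (clippedLoss_mem i n x).1
          rw [optimalAtScale, if_pos h]
          by_cases hc : ∑ n ∈ Finset.range T, clippedLoss i n x ≤ L / 2 ^ (k + 1)
          · have e : optimalWithin best i (L / 2 ^ (k + 1)) x = 1 := if_pos ⟨hi, hc⟩
            rw [e]
            exact (sub_nonpos.2 (optimalWithin_mem _ _ _ _).2).trans (by positivity)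
          · have h1 : 1 ≤ 2 ^ (k + 1) / L * ∑ n ∈ Finset.range T, clippedLoss i n x := by
              rw [not_le, div_lt_iff₀ (by positivity)] at hc
              rw [div_mul_eq_mul_div, one_le_div hL0]
              linarith
            exact ((sub_le_self _ (optimalWithin_mem _ _ _ _).1).trans
              (optimalWithin_mem _ _ _ _).2).trans h1
      _ = 2 ^ (k + 1) / L * bestLoss 𝒜 h𝒜 x := by rw [hb.bestLoss_eq h𝒜 hx, Finset.mul_sum]
      _ ≤ 2 ^ (k + 1) / L * L := by gcongr
      _ = 2 ^ (k + 1) := div_mul_cancel₀ _ hL0.ne'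
  · calc _ ≤ ∑ i ∈ best x, (1 : ℝ) :=
          Finset.sum_le_sum fun i _ => (optimalAtScale_mem hL0.le i k x).2
      _ = m := by simp [hm _ (hb.mem x)]
      _ ≤ 2 ^ k := by exact_mod_cast hmK
      _ ≤ 2 ^ (k + 1) := pow_le_pow_right₀ one_le_two k.le_succ

end scales

/-! ### Choice of parameters and the final bound. -/

/-- The main term at scale `k`: summing over arms gains the factor `√(d 2 ^ k)`. -/
theorem scale_term_le {d m k : ℕ} {L lam : ℝ} (hd : 0 < d) (hm : 0 < m)
    (hk : (2 : ℝ) ^ k ≤ 2 * m) (hL : 0 < L) (hlam : 1 / 2 ≤ lam) {ε : ℝ} (hε : 0 ≤ ε)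
    (hεd : ε ≤ (d : ℝ)⁻¹) {z : Fin d → ℝ} (hz : ∀ i, 0 ≤ z i) (hsum : ∑ i, z i ≤ 2 ^ (k + 1)) :
    ∑ i, (4 * (√(L / 2 ^ k))⁻¹ * (2 * (L / 2 ^ k) + 4 * L / m + (m * lam / L)⁻¹)
      + 2 * ((√(L / 2 ^ k))⁻¹)⁻¹) * √(z i + ε) ≤ 116 * √(d * L) := by
  have hd' : (0 : ℝ) < d := by exact_mod_cast hd
  have hm' : (0 : ℝ) < m := by exact_mod_cast hm
  set Λ : ℝ := L / 2 ^ k with hΛ_def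
  have hΛ : 0 < Λ := by positivity
  have hLm : L / m ≤ 2 * Λ := by
    rw [hΛ_def, div_le_iff₀ hm', ← mul_div_assoc, div_mul_eq_mul_div, le_div_iff₀ (by positivity)]
    nlinarith
  have hinv : (m * lam / L)⁻¹ ≤ 2 * (L / m) := by
    rw [inv_div, ← mul_div_assoc, div_le_div_iff₀ (by positivity) hm']
    nlinarith [mul_pos hL hm']
  have hs : 0 < √Λ := Real.sqrt_pos.2 hΛ
  have hcoef : 4 * (√Λ)⁻¹ * (2 * Λ + 4 * L / m + (m * lam / L)⁻¹) + 2 * ((√Λ)⁻¹)⁻¹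
      ≤ 58 * √Λ := by
    -- 14 = 2 + 4·2 + 2·2, from L/m ≤ 2Λ and γ⁻¹ ≤ 2L/m.
    have h1 : 2 * Λ + 4 * L / m + (m * lam / L)⁻¹ ≤ 14 * Λ := by
      rw [mul_div_assoc]
      linarith
    calc _ ≤ 4 * (√Λ)⁻¹ * (14 * Λ) + 2 * ((√Λ)⁻¹)⁻¹ := by gcongr
      _ = 58 * √Λ := by
        have e : (√Λ)⁻¹ * Λ = √Λ := by rw [inv_mul_eq_div, Real.div_sqrt]
        rw [inv_inv]
        linear_combination 56 * e
  -- Cauchy–Schwarz over the arms; ε ≤ 1/d makes the total regularization at most 1.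
  have hsqrt : ∑ i, √(z i + ε) ≤ √(d * (4 * 2 ^ k)) := by
    refine Real.le_sqrt_of_sq_le ?_
    calc (∑ i, √(z i + ε)) ^ 2 ≤ (Finset.univ : Finset (Fin d)).card * ∑ i, √(z i + ε) ^ 2 :=
          sq_sum_le_card_mul_sum_sq
      _ = d * (∑ i, z i + d * ε) := by
          rw [Finset.sum_congr rfl fun i _ => Real.sq_sqrt (add_nonneg (hz i) hε),
            Finset.sum_add_distrib]
          simp
      _ ≤ d * (2 ^ (k + 1) + d * (d : ℝ)⁻¹) := by gcongr
      _ ≤ d * (4 * 2 ^ k) := by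
          have : (1 : ℝ) ≤ 2 ^ k := one_le_pow₀ one_le_two
          rw [mul_inv_cancel₀ hd'.ne', pow_succ]
          gcongr
          linarith
  rw [← Finset.mul_sum]
  calc _ ≤ 58 * √Λ * √(d * (4 * 2 ^ k)) :=
        mul_le_mul hcoef hsqrt (Finset.sum_nonneg fun i _ => Real.sqrt_nonneg _) (by positivity)
    _ = 58 * √(Λ * (d * (4 * 2 ^ k))) := by rw [Real.sqrt_mul hΛ.le, mul_assoc]
    _ = 58 * √(2 ^ 2 * (d * L)) := by
        congr 2
        rw [hΛ_def]
        field_simp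
        ring
    _ = 116 * √(d * L) := by
        rw [Real.sqrt_mul (by positivity), Real.sqrt_sq zero_le_two]
        ring

/-- The error term at a single scale is bounded. -/
theorem exceed_term_le {m : ℕ} {L Λ : ℝ} (hm : 1 ≤ m) (hL : 2 ≤ L)
    (hlog : 1 / 2 ≤ Real.log L) :
    (m * Real.log L / L)⁻¹ * (L + 1) * (2 * √(2 * Real.exp (2 * (m * Real.log L / L) * Λ
      - m * Real.log L / L * (2 * Λ + 4 * L / m)))) ≤ 16 := by
  have hm' : (1 : ℝ) ≤ m := by exact_mod_cast hm
  have hL0 : 0 < L := by linarith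
  -- The margin 4L/m in the threshold, times γ = m log L / L, is 4 log L. The square root of the
  -- resulting L⁻⁴ cancels γ⁻¹(L + 1), which is of order L².
  have h1 : 2 * (m * Real.log L / L) * Λ - m * Real.log L / L * (2 * Λ + 4 * L / m)
      = -(4 * Real.log L) := by
    field_simp
    ring
  have h2 : Real.exp (-(4 * Real.log L)) = (L⁻¹ ^ 2) ^ 2 := by
    rw [Real.exp_neg, show 4 * Real.log L = Real.log (L ^ 4) by rw [Real.log_pow]; norm_num,
      Real.exp_log (by positivity)]
    ring
  have h3 : √(2 * (L⁻¹ ^ 2) ^ 2) ≤ 2 * L⁻¹ ^ 2 := by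
    refine Real.sqrt_le_iff.2 ⟨by positivity, ?_⟩
    have : 0 ≤ (L⁻¹ ^ 2) ^ 2 := by positivity
    nlinarith
  have h4 : (m * Real.log L / L)⁻¹ ≤ 2 * L := by
    rw [inv_div, div_le_iff₀ (by positivity)]
    nlinarith [mul_le_mul hm' hlog (by norm_num) (by positivity)]
  rw [h1, h2]
  calc _ ≤ 2 * L * (2 * L) * (2 * (2 * L⁻¹ ^ 2)) := by
        gcongr
        linarith
    _ = 16 := by
        field_simp
        norm_num

/-- First-order regret bound for actions of positive size. -/
theorem IsThompsonSampling.integral_regret_le {d m T : ℕ} {𝒜 : Finset (Action d)}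
    (h𝒜 : 𝒜.Nonempty) (hcard : ∀ B ∈ 𝒜, B.card = m) (hm : 1 ≤ m) {Ω : Type*}
    {mΩ : MeasurableSpace Ω} {P : Measure Ω} [IsProbabilityMeasure P] {loss : Ω → LossSeq d T}
    (hloss : Measurable loss) (h01 : ∀ᵐ ω ∂P, ∀ t i, loss ω t i ∈ Set.Icc (0 : ℝ) 1)
    {best : LossSeq d T → Action d} (hb : IsBestActionRule 𝒜 best) {play : Fin T → Ω → Action d}
    (hp : IsThompsonSampling P best loss play) {L : ℝ} (hL2 : 2 ≤ L)
    (hL : ∀ᵐ ω ∂P, bestLoss 𝒜 h𝒜 (loss ω) ≤ L) :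
    ∫ ω, regret 𝒜 h𝒜 (loss ω) (fun t => play t ω) ∂P ≤
      232 * ((1 + Real.log m) * √(d * L) + m * (d : ℝ) ^ 2 * Real.log L ^ 2
        + d * Real.log T) := by
  have hL0 : 0 < L := by linarith
  have hlog2 : (1 : ℝ) / 2 ≤ Real.log 2 := by linarith [Real.log_two_gt_d9]
  have hlog : 1 / 2 ≤ Real.log L := hlog2.trans (Real.log_le_log two_pos hL2)
  have hmd : m ≤ d := by
    obtain ⟨B, hB⟩ := h𝒜
    rw [← hcard B hB]
    exact (Finset.card_le_univ B).trans_eq (Fintype.card_fin d)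
  have hd : 1 ≤ d := hm.trans hmd
  have hm' : (1 : ℝ) ≤ m := by exact_mod_cast hm
  have hd' : (1 : ℝ) ≤ d := by exact_mod_cast hd
  -- The last scale has Λ_K of order L/m, where the trivial count m is already of order 2^K.
  set K := Nat.clog 2 m with hK_def
  have hmK : m ≤ 2 ^ K := Nat.le_pow_clog one_lt_two m
  have hKm : 2 ^ K ≤ 2 * m := by
    rcases hm.eq_or_lt with h | h
    · simp [hK_def, ← h]
    · have h1 := Nat.pow_pred_clog_lt_self one_lt_two h
      have h2 : 0 < K := Nat.clog_pos one_lt_two h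
      obtain ⟨K', hK'⟩ : ∃ K', K = K' + 1 := ⟨K - 1, by omega⟩
      rw [← hK_def, hK', Nat.pred_succ] at h1
      rw [hK', pow_succ]
      omega
  have hKm' : (2 : ℝ) ^ K ≤ 2 * m := by exact_mod_cast hKm
  have hK_le : (K : ℝ) + 1 ≤ 2 * m := by
    have : K + 1 ≤ 2 ^ K := Nat.lt_two_pow_self
    exact_mod_cast this.trans hKm
  have hlogm : 0 ≤ Real.log m := Real.log_nonneg hm'
  have hK_log : (K : ℝ) + 1 ≤ 2 * (1 + Real.log m) := by
    have h1 : K * Real.log 2 ≤ Real.log 2 + Real.log m := by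
      rw [← Real.log_pow, ← Real.log_mul two_ne_zero (by positivity)]
      exact Real.log_le_log (by positivity) hKm'
    nlinarith
  -- Rare rounds then cost 2γL = 2m log L per arm, while γ⁻¹ is at most of order L/m and so no
  -- larger than the thresholds.
  set γ : ℝ := m * Real.log L / L with hγ_def
  have hγ : 0 < γ := by positivity
  set ε : ℝ := min γ (d : ℝ)⁻¹ with hε_def
  have hε : 0 < ε := lt_min hγ (by positivity)
  have hZm : ∀ i k n, Measurable[pastFullInfo loss play n]
      (fun ω => optimalAtScale best L K i k (loss ω)) := fun i k n =>
    (hb.measurable_optimalAtScale i k).comp ((comap_measurable loss).mono le_sup_left le_rfl)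
  have hsum : ∀ k ≤ K, ∑ i, ∫ ω, optimalAtScale best L K i k (loss ω) ∂P ≤ 2 ^ (k + 1) := by
    intro k hk
    have hZb : ∀ i, Integrable (fun ω => optimalAtScale best L K i k (loss ω)) P := fun i =>
      (BddMeas.of_mem_Icc ((hb.measurable_optimalAtScale i k).comp hloss)
        fun ω => optimalAtScale_mem hL0.le i k (loss ω)).integrable le_rfl
    rw [← integral_finsetSum _ fun i _ => hZb i]
    calc _ ≤ ∫ _, (2 : ℝ) ^ (k + 1) ∂P := by
          refine integral_mono_ae (integrable_finsetSum _ fun i _ => hZb i)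
            (integrable_const _) ?_
          filter_upwards [h01, hL] with ω h1 h2
          exact hb.sum_optimalAtScale_le h𝒜 hcard hmK hL0 h1 h2 hk
      _ = 2 ^ (k + 1) := by simp
  have harm : ∀ i, _ := fun i =>
    (hp.armModel hloss h01 h𝒜 hb hL i).sum_integral_le hε (min_le_left _ _) hL0.le
      (fun ω hω => le_of_optimalWithin_ne_zero hω) (Finset.range (K + 1))
      (Z := fun k ω => optimalAtScale best L K i k (loss ω)) (Λ := fun k => L / 2 ^ k)
      (θ := fun k => 2 * (L / 2 ^ k) + 4 * L / m) (η := fun k => (√(L / 2 ^ k))⁻¹)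
      (fun k _ => hZm i k) (fun k _ ω => optimalAtScale_mem hL0.le i k _)
      (fun ω => sum_optimalAtScale i _) (fun k _ ω hω => le_of_optimalAtScale_ne_zero hL0.le hω)
      (fun k _ => by positivity) (fun k _ => by positivity)
  rw [hp.integral_regret hloss h01 h𝒜 hb hL]
  refine (Finset.sum_le_sum fun i _ => harm i).trans ?_
  rw [Finset.sum_add_distrib, Finset.sum_comm]
  have hscale : ∀ k ∈ Finset.range (K + 1), ∑ i,
      ((4 * (√(L / 2 ^ k))⁻¹ * (2 * (L / 2 ^ k) + 4 * L / m + γ⁻¹)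
        + 2 * ((√(L / 2 ^ k))⁻¹)⁻¹) * √(∫ ω, optimalAtScale best L K i k (loss ω) ∂P + ε)
        + γ⁻¹ * (L + 1) * (2 * √(2 * Real.exp (2 * γ * (L / 2 ^ k)
          - γ * (2 * (L / 2 ^ k) + 4 * L / m))))) ≤ 116 * √(d * L) + 16 * d := by
    intro k hk
    have hk' : k ≤ K := Nat.lt_succ_iff.1 (Finset.mem_range.1 hk)
    rw [Finset.sum_add_distrib]
    refine add_le_add (scale_term_le hd hm
      ((pow_le_pow_right₀ one_le_two hk').trans hKm') hL0 hlog hε.le (min_le_right _ _)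
      (fun i => integral_nonneg fun ω => (optimalAtScale_mem hL0.le i k _).1) (hsum k hk')) ?_
    refine (Finset.sum_le_sum fun i _ => exceed_term_le hm hL2 hlog).trans ?_
    simp [mul_comm]
  have hγL : γ * L = m * Real.log L := div_mul_cancel₀ _ hL0.ne'
  calc _ ≤ ∑ _i : Fin d, (2 * γ * L + Real.log T + 2)
        + ∑ _k ∈ Finset.range (K + 1), (116 * √(d * L) + 16 * d) :=
        add_le_add le_rfl (Finset.sum_le_sum hscale)
    _ = d * (2 * (m * Real.log L) + Real.log T + 2)
        + (K + 1) * (116 * √(d * L)) + (K + 1) * (16 * d) := by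
        rw [← hγL]
        simp only [Finset.sum_const, Finset.card_univ, Fintype.card_fin, Finset.card_range,
          nsmul_eq_mul]
        push_cast
        ring
    -- The number of scales K + 1 is bounded by 2(1 + log m) in the main term, but by 2m in the
    -- error term, which fits into m d² log² L.
    _ ≤ d * (2 * (m * Real.log L) + Real.log T + 2)
        + 2 * (1 + Real.log m) * (116 * √(d * L)) + 2 * m * (16 * d) := by gcongr
    _ ≤ _ := by
        have hT : 0 ≤ Real.log T := Real.log_natCast_nonneg T
        have h1 : 0 ≤ d * Real.log T := by positivity
        have h2 : (d : ℝ) ≤ d ^ 2 := by nlinarith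
        have h3 : (1 : ℝ) ≤ 4 * Real.log L ^ 2 := by nlinarith
        have h4 : Real.log L ≤ 2 * Real.log L ^ 2 := by nlinarith
        have h5 : (m : ℝ) * d * Real.log L ≤ m * d ^ 2 * (2 * Real.log L ^ 2) := by gcongr
        have h6 : (m : ℝ) * d * 1 ≤ m * d ^ 2 * (4 * Real.log L ^ 2) := by gcongr
        have h7 : 1 * (d : ℝ) ≤ m * d := by gcongr
        have h8 : 0 ≤ (m : ℝ) * d ^ 2 * Real.log L ^ 2 := by positivity
        nlinarith

/-- If all actions are empty, the expected regret vanishes. -/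
theorem IsThompsonSampling.integral_regret_eq_zero {d T : ℕ} {𝒜 : Finset (Action d)}
    (h𝒜 : 𝒜.Nonempty) (hcard : ∀ B ∈ 𝒜, B.card = 0) {Ω : Type*}
    {mΩ : MeasurableSpace Ω} {P : Measure Ω} [IsProbabilityMeasure P] {loss : Ω → LossSeq d T}
    (hloss : Measurable loss) (h01 : ∀ᵐ ω ∂P, ∀ t i, loss ω t i ∈ Set.Icc (0 : ℝ) 1)
    {best : LossSeq d T → Action d} (hb : IsBestActionRule 𝒜 best) {play : Fin T → Ω → Action d}
    (hp : IsThompsonSampling P best loss play) {L : ℝ}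
    (hL : ∀ᵐ ω ∂P, bestLoss 𝒜 h𝒜 (loss ω) ≤ L) :
    ∫ ω, regret 𝒜 h𝒜 (loss ω) (fun t => play t ω) ∂P = 0 := by
  rw [hp.integral_regret hloss h01 h𝒜 hb hL]
  refine Finset.sum_eq_zero fun i _ => Finset.sum_eq_zero fun n _ => ?_
  have h1 : ∀ ω, optimalWithin best i L (loss ω) = 0 := fun ω => by
    simp [optimalWithin, Finset.card_eq_zero.1 (hcard _ (hb.mem (loss ω)))]
  simp [h1, posterior]

end SemiBandit

theorem mainTheorem4 :
    ∃ C : ℝ, 0 < C ∧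
      ∀ (d m T : ℕ) (𝒜 : Finset (SemiBandit.Action d)) (h𝒜 : 𝒜.Nonempty)
        (_ : ∀ A ∈ 𝒜, A.card = m)
        (Ω : Type*) [MeasurableSpace Ω] (P : MeasureTheory.Measure Ω)
        [MeasureTheory.IsProbabilityMeasure P]
        (loss : Ω → SemiBandit.LossSeq d T) (_ : Measurable loss)
        (_ : ∀ᵐ ω ∂P, ∀ t i, loss ω t i ∈ Set.Icc (0 : ℝ) 1)
        (best : SemiBandit.LossSeq d T → SemiBandit.Action d)
        (_ : SemiBandit.IsBestActionRule 𝒜 best)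
        (play : Fin T → Ω → SemiBandit.Action d)
        (_ : SemiBandit.IsThompsonSampling P best loss play)
        (Lstar : ℝ) (_ : 2 ≤ Lstar)
        (_ : ∀ᵐ ω ∂P, SemiBandit.bestLoss 𝒜 h𝒜 (loss ω) ≤ Lstar),
        ∫ ω, SemiBandit.regret 𝒜 h𝒜 (loss ω) (fun t => play t ω) ∂P ≤
          C * ((1 + Real.log m) * Real.sqrt (d * Lstar)
            + m * (d : ℝ) ^ 2 * Real.log Lstar ^ 2
            + d * Real.log T) := by
  refine ⟨232, by norm_num, ?_⟩
  intro d m T 𝒜 h𝒜 hcard Ω _ P _ loss hloss h01 best hb play hp L hL2 hL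
  -- For m = 0 the choice of γ would degenerate to 0; the regret then vanishes.
  rcases Nat.eq_zero_or_pos m with rfl | hm
  · rw [hp.integral_regret_eq_zero h𝒜 hcard hloss h01 hb hL]
    have := Real.log_natCast_nonneg T
    have : 0 ≤ Real.log ((0 : ℕ) : ℝ) := Real.log_natCast_nonneg 0
    positivity
  · exact hp.integral_regret_le h𝒜 hcard hm hloss h01 hb hL2 hL
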